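/- Let $M$ be a connected, orientable smooth manifold of dimension $3$ (without boundary, not necessarily compact). The following are equivalent: 1. $M$ admits a coKähler structure, i.e. an endomorphism field $\theta$ of $TM$, a vector field $\xi$, a $1$-form $\eta$ and a Riemannian metric $g$, all smooth, such that $\eta(\xi)=1$, $\theta^2=-\mathrm{Id}+\eta\otimes\xi$ and $g(\theta X,\theta Y)=g(X,Y)-\eta(X)\eta(Y)$ (an almost contact metric structure), which is cosymplectic, $d\eta=0$ and $d\Omega=0$ for the fundamental $2$-form $\Omega(X,Y)=g(X,\theta Y)$, and normal, $N_\theta+d\eta\otimes\xi=0$, where $N_\theta(X,Y)=\theta^2[X,Y]-\theta([\theta X,Y]+[X,\theta Y])+[\theta X,\theta Y]$. 2. There are a smooth Riemannian metric $g$ on $M$ and a smooth $(1,1)$-tensor field $\theta$ on $M$, not identically zero and skew-symmetric, $g(\theta X,Y)=-g(X,\theta Y)$, which solves the gauge equation of the Levi-Civita connection $\nabla^{lc}$ of $g$: $\nabla^{lc}\theta=0$, i.e. $\nabla^{lc}_X(\theta Y)=\theta\nabla^{lc}_XY$ for all vector fields $X,Y$. -/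

import Mathlib

open scoped Manifold ContDiff Bundle

noncomputable section

namespace CoKahler

/-- The model space `ℝⁿ` with its Euclidean norm. -/
abbrev Model (n : ℕ) : Type := EuclideanSpace ℝ (Fin n)

section Tensors

variable {n : ℕ} {M : Type*} [TopologicalSpace M] [ChartedSpace (Model n) M]

/-- A smooth vector field `X ∈ 𝔛(M)`. -/
def SmoothField [IsManifold (𝓡 n) ∞ M] (X : (x : M) → TangentSpace (𝓡 n) x) : Prop :=
  ContMDiff (𝓡 n) ((𝓡 n).prod 𝓘(ℝ, Model n)) ∞
    (fun x ↦ Bundle.TotalSpace.mk' (Model n) (E := fun y : M ↦ TangentSpace (𝓡 n) y) x (X x))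

/-- A smooth `1`-form: a smooth section of `Hom(TM, ℝ)`. -/
def SmoothOneForm [IsManifold (𝓡 n) ∞ M] (η : (x : M) → TangentSpace (𝓡 n) x →L[ℝ] ℝ) : Prop :=
  ContMDiff (𝓡 n) ((𝓡 n).prod 𝓘(ℝ, Model n →L[ℝ] ℝ)) ∞
    (fun x ↦ Bundle.TotalSpace.mk' (Model n →L[ℝ] ℝ)
      (E := fun y : M ↦ TangentSpace (𝓡 n) y →L[ℝ] Bundle.Trivial M ℝ y) x (η x))

/-- A smooth `(1,1)`-tensor field: a smooth section of `Hom(TM, TM)`. -/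
def SmoothEndo [IsManifold (𝓡 n) ∞ M]
    (θ : (x : M) → TangentSpace (𝓡 n) x →L[ℝ] TangentSpace (𝓡 n) x) : Prop :=
  ContMDiff (𝓡 n) ((𝓡 n).prod 𝓘(ℝ, Model n →L[ℝ] Model n)) ∞
    (fun x ↦ Bundle.TotalSpace.mk' (Model n →L[ℝ] Model n)
      (E := fun y : M ↦ TangentSpace (𝓡 n) y →L[ℝ] TangentSpace (𝓡 n) y) x (θ x))

/-- The derivative `X · f` of a function along a vector field, at the point `x`. -/
def lieD (X : (x : M) → TangentSpace (𝓡 n) x) (f : M → ℝ) (x : M) : ℝ :=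
  mvfderiv (𝓡 n) f x (X x)

/-- The Lie bracket `[X, Y]` of vector fields. -/
def bracket (X Y : (x : M) → TangentSpace (𝓡 n) x) : (x : M) → TangentSpace (𝓡 n) x :=
  VectorField.mlieBracket (𝓡 n) X Y

/-- The vector field `θX`. -/
def applyEndo (θ : (x : M) → TangentSpace (𝓡 n) x →L[ℝ] TangentSpace (𝓡 n) x)
    (X : (x : M) → TangentSpace (𝓡 n) x) : (x : M) → TangentSpace (𝓡 n) x :=
  fun x ↦ θ x (X x)

/-- Exterior derivative of a `1`-form `η`, evaluated on vector fields:
`dη(X, Y) = X·η(Y) - Y·η(X) - η([X, Y])`. -/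
def dOne (η : (x : M) → TangentSpace (𝓡 n) x →L[ℝ] ℝ)
    (X Y : (x : M) → TangentSpace (𝓡 n) x) (x : M) : ℝ :=
  lieD X (fun y ↦ η y (Y y)) x - lieD Y (fun y ↦ η y (X y)) x - η x (bracket X Y x)

/-- Exterior derivative of a `2`-form `Ω`, evaluated on vector fields:
`dΩ(X, Y, Z) = X·Ω(Y, Z) - Y·Ω(X, Z) + Z·Ω(X, Y) - Ω([X, Y], Z) + Ω([X, Z], Y) - Ω([Y, Z], X)`. -/
def dTwo (Ω : (x : M) → TangentSpace (𝓡 n) x → TangentSpace (𝓡 n) x → ℝ)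
    (X Y Z : (x : M) → TangentSpace (𝓡 n) x) (x : M) : ℝ :=
  lieD X (fun y ↦ Ω y (Y y) (Z y)) x - lieD Y (fun y ↦ Ω y (X y) (Z y)) x
    + lieD Z (fun y ↦ Ω y (X y) (Y y)) x
    - Ω x (bracket X Y x) (Z x) + Ω x (bracket X Z x) (Y x) - Ω x (bracket Y Z x) (X x)

/-- The Nijenhuis torsion
`N_θ(X, Y) = θ²[X, Y] - θ([θX, Y] + [X, θY]) + [θX, θY]`. -/
def nijenhuis (θ : (x : M) → TangentSpace (𝓡 n) x →L[ℝ] TangentSpace (𝓡 n) x)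
    (X Y : (x : M) → TangentSpace (𝓡 n) x) (x : M) : TangentSpace (𝓡 n) x :=
  θ x (θ x (bracket X Y x))
    - θ x (bracket (applyEndo θ X) Y x + bracket X (applyEndo θ Y) x)
    + bracket (applyEndo θ X) (applyEndo θ Y) x

end Tensors

/-- A smooth Riemannian metric on the `n`-manifold `M`. -/
abbrev Metric (n : ℕ) (M : Type*) [TopologicalSpace M] [ChartedSpace (Model n) M]
    [IsManifold (𝓡 n) ∞ M] :=
  Bundle.ContMDiffRiemannianMetric (𝓡 n) ∞ (Model n) (fun x : M ↦ TangentSpace (𝓡 n) x)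

/-- A smooth manifold without boundary is orientable if it has an atlas of smooth charts whose
transition maps all have positive Jacobian determinant. -/
def Orientable (n : ℕ) (M : Type*) [TopologicalSpace M] [ChartedSpace (Model n) M] : Prop :=
  ∃ A : Set (OpenPartialHomeomorph M (Model n)),
    A ⊆ IsManifold.maximalAtlas (𝓡 n) ∞ M ∧
    (∀ x : M, ∃ e ∈ A, x ∈ e.source) ∧
    ∀ e ∈ A, ∀ e' ∈ A, ∀ x ∈ e.source ∩ e'.source,
      0 < (fderiv ℝ (fun y ↦ e' (e.symm y)) (e x)).det

section Structures

variable (n : ℕ) (M : Type*) [TopologicalSpace M] [ChartedSpace (Model n) M]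
  [IsManifold (𝓡 n) ∞ M]

/-- An almost contact metric structure `(θ, ξ, η, g)` on `M`: an almost contact structure
`(θ, ξ, η)` with an adapted Riemannian metric `g`. -/
structure AlmostContactMetric where
  /-- the structure endomorphism -/
  θ : (x : M) → TangentSpace (𝓡 n) x →L[ℝ] TangentSpace (𝓡 n) x
  /-- the Reeb vector field -/
  ξ : (x : M) → TangentSpace (𝓡 n) x
  /-- the contact `1`-form -/
  η : (x : M) → TangentSpace (𝓡 n) x →L[ℝ] ℝ
  /-- the adapted metric -/
  g : Metric n M
  smooth_θ : SmoothEndo θ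
  smooth_ξ : SmoothField ξ
  smooth_η : SmoothOneForm η
  η_ξ : ∀ x, η x (ξ x) = 1
  θ_sq : ∀ x (v : TangentSpace (𝓡 n) x), θ x (θ x v) = -v + η x v • ξ x
  adapted : ∀ x (v w : TangentSpace (𝓡 n) x),
    g.inner x (θ x v) (θ x w) = g.inner x v w - η x v * η x w

variable {n M}

/-- The fundamental `2`-form `Ω(X, Y) = g(X, θY)`. -/
def AlmostContactMetric.Ω (S : AlmostContactMetric n M) (x : M) (v w : TangentSpace (𝓡 n) x) : ℝ :=
  S.g.inner x v (S.θ x w)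

/-- The structure is cosymplectic: `dη = 0` and `dΩ = 0`. -/
def AlmostContactMetric.IsCosymplectic (S : AlmostContactMetric n M) : Prop :=
  (∀ X Y : (x : M) → TangentSpace (𝓡 n) x, SmoothField X → SmoothField Y →
    ∀ x, dOne S.η X Y x = 0) ∧
  ∀ X Y Z : (x : M) → TangentSpace (𝓡 n) x, SmoothField X → SmoothField Y → SmoothField Z →
    ∀ x, dTwo S.Ω X Y Z x = 0

/-- The structure is normal: `N_θ + dη ⊗ ξ = 0`. -/
def AlmostContactMetric.IsNormal (S : AlmostContactMetric n M) : Prop :=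
  ∀ X Y : (x : M) → TangentSpace (𝓡 n) x, SmoothField X → SmoothField Y →
    ∀ x, nijenhuis S.θ X Y x + dOne S.η X Y x • S.ξ x = 0

/-- The structure is coKähler: cosymplectic and normal. -/
def AlmostContactMetric.IsCoKahler (S : AlmostContactMetric n M) : Prop :=
  S.IsCosymplectic ∧ S.IsNormal

/-- `D` is the Levi-Civita connection of `g`: torsion-free and metric. (Its value on vector fields
which are not differentiable at a point carries no information.) -/
def IsLeviCivita (g : Metric n M)
    (D : CovariantDerivative (𝓡 n) (Model n) (fun x : M ↦ TangentSpace (𝓡 n) x)) : Prop :=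
  haveI : IsManifold (𝓡 n) 2 M := inferInstance
  (∀ x, D.torsion x = 0) ∧
  letI : Bundle.RiemannianBundle (fun x : M ↦ TangentSpace (𝓡 n) x) := ⟨g.toRiemannianMetric⟩
  D.IsMetricCompatible

end Structures

section Admits

variable (n : ℕ) (M : Type*) [TopologicalSpace M] [ChartedSpace (Model n) M]
  [IsManifold (𝓡 n) ∞ M]

/-- `M` admits a coKähler structure. -/
def AdmitsCoKahler : Prop := ∃ S : AlmostContactMetric n M, S.IsCoKahler

variable {n M}

/-- `θ` is skew-symmetric with respect to `g`. -/
def IsSkew (g : Metric n M)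
    (θ : (x : M) → TangentSpace (𝓡 n) x →L[ℝ] TangentSpace (𝓡 n) x) : Prop :=
  ∀ x (v w : TangentSpace (𝓡 n) x), g.inner x (θ x v) w = -g.inner x v (θ x w)

/-- The gauge equation `∇θ = 0` of the Levi-Civita connection `∇` of `g`, that is
`∇_X (θY) = θ (∇_X Y)` for all vector fields `X`, `Y`. -/
def SolvesGauge (g : Metric n M)
    (θ : (x : M) → TangentSpace (𝓡 n) x →L[ℝ] TangentSpace (𝓡 n) x) : Prop :=
  ∃ D : CovariantDerivative (𝓡 n) (Model n) (fun x : M ↦ TangentSpace (𝓡 n) x), IsLeviCivita g D ∧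
    ∀ X Y : (x : M) → TangentSpace (𝓡 n) x, SmoothField X → SmoothField Y →
      ∀ x, D (applyEndo θ Y) x (X x) = θ x (D Y x (X x))

end Admits

end CoKahler

end

open scoped Topology

noncomputable section

namespace CoKahler

open Bundle FiberBundle

/-! ### Smooth vector fields and tensors; the Levi-Civita property. -/

section Basic

variable {n : ℕ} {M : Type*} [TopologicalSpace M] [ChartedSpace (Model n) M]
  [IsManifold (𝓡 n) ∞ M]

/-! Everything is expressed through the Levi-Civita connection `∇` of the metric. Since it is
torsion-free and metric, `dη`, `dΩ` and `N_θ` are algebraic in `b = ∇ξ` and `A = ∇θ` (`dOne_inner`,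
`dTwo_fundamental`, `nijenhuis_eq`).

From coKähler to the gauge equation, the structure's own `g` and `θ` work. Differentiating `θ² = -Id
+ η ⊗ ξ` and the skewness of `θ` shows that in dimension 3 `A` is determined by `b`. Closedness of
`η` makes `b` symmetric, normality makes it commute with the quarter turn `θ` of the plane `ξ⊥`, so
`b` is a multiple of the identity there, and `dΩ = 0` makes its trace vanish. Hence `b = 0` and `A =
0` (`endoDeriv_eq_zero`).

Conversely, a skew `θ` on a Euclidean 3-space is an infinitesimal rotation about an axis. If `θ` is
parallel its squared speed, `-tr(θ²)/2`, is constant (`speedSq_eq`), so `θ` vanishes nowhere and a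
constant rescaling gives it speed one. Orientability selects one of the two unit vectors on each
axis, smoothly (`exists_unit_axis`); call it `ξ`. Then `θ² = -Id + η ⊗ ξ` with `η = g(ξ, ·)`.
Differentiating `θξ = 0` and `|ξ| = 1` gives `∇ξ = 0`, so all three obstructions vanish
(`isCoKahler_of_parallel`). -/

instance (x : M) : FiniteDimensional ℝ (TangentSpace (𝓡 n) x) :=
  inferInstanceAs (FiniteDimensional ℝ (Model n))

instance (x : M) : T2Space (TangentSpace (𝓡 n) x) := inferInstanceAs (T2Space (Model n))

omit [IsManifold (𝓡 n) ∞ M] in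
lemma finrank_tangentSpace (x : M) : Module.finrank ℝ (TangentSpace (𝓡 n) x) = n :=
  (finrank_euclideanSpace_fin (𝕜 := ℝ) (n := n) :)

/-- The vector field `X` is differentiable at `x`. -/
abbrev FieldMDiffAt (X : (x : M) → TangentSpace (𝓡 n) x) (x : M) : Prop :=
  MDifferentiableAt (𝓡 n) ((𝓡 n).prod 𝓘(ℝ, Model n))
    (fun x ↦ TotalSpace.mk' (Model n) (E := fun y : M ↦ TangentSpace (𝓡 n) y) x (X x)) x

/-- The vector field `X` is smooth at `x`. -/
abbrev SmoothFieldAt (X : (x : M) → TangentSpace (𝓡 n) x) (x : M) : Prop :=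
  ContMDiffAt (𝓡 n) ((𝓡 n).prod 𝓘(ℝ, Model n)) ∞
    (fun x ↦ TotalSpace.mk' (Model n) (E := fun y : M ↦ TangentSpace (𝓡 n) y) x (X x)) x

lemma SmoothField.mdifferentiableAt {X : (x : M) → TangentSpace (𝓡 n) x} (hX : SmoothField X)
    (x : M) : FieldMDiffAt X x :=
  (hX x).mdifferentiableAt (by simp)

/-- Every tangent vector is the value of a global smooth vector field. -/
lemma exists_smoothField [T2Space M] (x : M) (v : TangentSpace (𝓡 n) x) :
    ∃ X : (x : M) → TangentSpace (𝓡 n) x, SmoothField X ∧ X x = v := by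
  obtain ⟨s, hs, hsX⟩ := exists_contMDiffOn_extend (k := ∞) (𝓡 n) (Model n) v
  obtain ⟨u, hus, hu, hxu⟩ := mem_nhds_iff.1 hs
  obtain ⟨f, hf⟩ := (SmoothBumpFunction.nhds_basis_tsupport (I := 𝓡 n) x).mem_iff.1
    (hu.mem_nhds hxu)
  refine ⟨(f : M → ℝ) • extend (Model n) v, ?_, ?_⟩
  · exact (ContMDiffOn.smul_section_of_tsupport (u := u)
      (f.contMDiff.contMDiffOn) hu hf.2 (hsX.mono hus) :)
  · simp

variable {θ : (x : M) → TangentSpace (𝓡 n) x →L[ℝ] TangentSpace (𝓡 n) x}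
  {g : Metric n M}
  {X Y Z : (x : M) → TangentSpace (𝓡 n) x} {x : M}

lemma SmoothEndo.mdifferentiableAt_apply (hθ : SmoothEndo θ) (hX : FieldMDiffAt X x) :
    FieldMDiffAt (applyEndo θ X) x :=
  MDifferentiableAt.clm_bundle_apply (b := id) (E₁ := fun y : M ↦ TangentSpace (𝓡 n) y)
    (E₂ := fun y : M ↦ TangentSpace (𝓡 n) y) ((hθ x).mdifferentiableAt (by simp)) hX

lemma SmoothEndo.contMDiffAt_apply (hθ : SmoothEndo θ) (hX : SmoothFieldAt X x) :
    SmoothFieldAt (applyEndo θ X) x :=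
  ContMDiffAt.clm_bundle_apply (b := id) (E₁ := fun y : M ↦ TangentSpace (𝓡 n) y)
    (E₂ := fun y : M ↦ TangentSpace (𝓡 n) y) (hθ x) hX

lemma mdifferentiableAt_inner (g : Metric n M) (hX : FieldMDiffAt X x) (hY : FieldMDiffAt Y x) :
    MDifferentiableAt (𝓡 n) 𝓘(ℝ) (fun y ↦ g.inner y (X y) (Y y)) x :=
  letI : RiemannianBundle (fun x : M ↦ TangentSpace (𝓡 n) x) := ⟨g.toRiemannianMetric⟩
  MDifferentiableAt.inner_bundle (b := id) hX hY

lemma contMDiffAt_inner (g : Metric n M) (hX : SmoothFieldAt X x) (hY : SmoothFieldAt Y x) :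
    ContMDiffAt (𝓡 n) 𝓘(ℝ) ∞ (fun y ↦ g.inner y (X y) (Y y)) x :=
  letI : RiemannianBundle (fun x : M ↦ TangentSpace (𝓡 n) x) := ⟨g.toRiemannianMetric⟩
  ContMDiffAt.inner_bundle (b := id) hX hY

lemma smoothOneForm_inner (g : Metric n M) (hX : SmoothField X) :
    SmoothOneForm (fun y ↦ g.inner y (X y)) := fun x ↦
  ContMDiffAt.clm_bundle_apply (b := id) (E₁ := fun y : M ↦ TangentSpace (𝓡 n) y)
    (F₂ := Model n →L[ℝ] ℝ)
    (E₂ := fun y : M ↦ TangentSpace (𝓡 n) y →L[ℝ] Bundle.Trivial M ℝ y) (g.contMDiff x) (hX x)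

lemma SmoothEndo.const_smul (hθ : SmoothEndo θ) (c : ℝ) : SmoothEndo (c • θ) :=
  ContMDiff.const_smul_section (V := fun y : M ↦ TangentSpace (𝓡 n) y →L[ℝ] TangentSpace (𝓡 n) y)
    hθ

variable {D : CovariantDerivative (𝓡 n) (Model n) (fun x : M ↦ TangentSpace (𝓡 n) x)}

lemma isLeviCivita_iff : IsLeviCivita g D ↔
    (∀ (x : M) (X Y : (x : M) → TangentSpace (𝓡 n) x), FieldMDiffAt X x → FieldMDiffAt Y x →
      D Y x (X x) - D X x (Y x) = bracket X Y x) ∧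
    ∀ (x : M) (X Y Z : (x : M) → TangentSpace (𝓡 n) x), FieldMDiffAt X x → FieldMDiffAt Y x →
      FieldMDiffAt Z x → lieD X (fun y ↦ g.inner y (Y y) (Z y)) x =
        g.inner x (D Y x (X x)) (Z x) + g.inner x (Y x) (D Z x (X x)) := by
  unfold IsLeviCivita
  refine and_congr ?_ ?_
  · rw [← funext_iff]
    exact (D.torsion_eq_zero_iff).trans ⟨fun h x X Y ↦ h, fun h X Y x ↦ h x X Y⟩
  · let _ : RiemannianBundle (fun x : M ↦ TangentSpace (𝓡 n) x) := ⟨g.toRiemannianMetric⟩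
    exact (D.isMetricCompatible_iff).trans ⟨fun h x X Y Z ↦ h, fun h x X Y Z ↦ h x X Y Z⟩

end Basic

/-! ### Pointwise Koszul formula. -/

section Koszul

/-- The algebraic part of the Koszul formula: a tensor correcting a connection with torsion `T` and
metric derivative `m` to a torsion-free metric one. -/
lemma exists_koszul_tensor {V : Type*} [AddCommGroup V] [Module ℝ V] [FiniteDimensional ℝ V]
    (g : LinearMap.BilinForm ℝ V) (hsymm : ∀ v w, g v w = g w v) (hpos : ∀ v, v ≠ 0 → 0 < g v v)
    (T : V →ₗ[ℝ] V →ₗ[ℝ] V) (hT : ∀ u v, T u v = -T v u)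
    (m : V →ₗ[ℝ] V →ₗ[ℝ] V →ₗ[ℝ] ℝ) (hm : ∀ v w u, m v w u = m w v u) :
    ∃ a : V →ₗ[ℝ] V →ₗ[ℝ] V, (∀ u v, T u v + a v u - a u v = 0) ∧
      ∀ v w u, m v w u = g (a v u) w + g v (a w u) := by
  have hnd : g.Nondegenerate := by
    refine ⟨fun v hv ↦ ?_, fun v hv ↦ ?_⟩ <;>
    · by_contra h
      exact (hpos v h).ne' (hv v)
  -- The functional `2 g(a v u, ·)` forced by the two requirements: permute the metric condition
  -- cyclically and eliminate with the torsion condition.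
  let F (v u : V) : Module.Dual ℝ V := (m v).flip u + (m u).flip v - m u v - g (T u v)
    + (LinearMap.flip g v).comp (T u) + (LinearMap.flip g u).comp (T v)
  have hF₁ (v v' u : V) : F (v + v') u = F v u + F v' u := by
    refine LinearMap.ext fun w ↦ ?_
    simp [F]
    ring
  have hF₂ (c : ℝ) (v u : V) : F (c • v) u = c • F v u := by
    refine LinearMap.ext fun w ↦ ?_
    simp [F]
    ring
  have hF₃ (v u u' : V) : F v (u + u') = F v u + F v u' := by
    refine LinearMap.ext fun w ↦ ?_
    simp [F]
    ring
  have hF₄ (c : ℝ) (v u : V) : F v (c • u) = c • F v u := by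
    refine LinearMap.ext fun w ↦ ?_
    simp [F]
    ring
  let a : V →ₗ[ℝ] V →ₗ[ℝ] V := LinearMap.mk₂ ℝ
    (fun v u ↦ (2⁻¹ : ℝ) • (g.toDual hnd).symm (F v u))
    (fun v v' u ↦ by rw [hF₁, map_add, smul_add])
    (fun c v u ↦ by rw [hF₂, map_smul, smul_comm])
    (fun v u u' ↦ by rw [hF₃, map_add, smul_add])
    (fun c v u ↦ by rw [hF₄, map_smul, smul_comm])
  have ha (v u w) : g (a v u) w = 2⁻¹ * F v u w := by
    simp only [a, LinearMap.mk₂_apply, map_smul, LinearMap.smul_apply, smul_eq_mul]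
    rw [LinearMap.BilinForm.apply_toDual_symm_apply]
  have ext_g (v w : V) (h : ∀ z, g v z = g w z) : v = w := by
    rw [← sub_eq_zero]
    by_contra h0
    exact (hpos _ h0).ne' (by rw [map_sub g, LinearMap.sub_apply, h, sub_self])
  refine ⟨a, fun u v ↦ ext_g _ _ fun z ↦ ?_, fun v w u ↦ ?_⟩
  · have h1 := congrArg (fun y ↦ g y z) (hT v u)
    simp only [map_neg, LinearMap.neg_apply] at h1
    simp only [map_sub, map_add, LinearMap.sub_apply, LinearMap.add_apply, ha, map_zero,
      LinearMap.zero_apply]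
    simp only [F, LinearMap.sub_apply, LinearMap.add_apply, LinearMap.flip_apply,
      LinearMap.comp_apply]
    rw [h1, hm u v z]
    ring
  · have h1 := congrArg (fun y ↦ g y u) (hT v w)
    simp only [map_neg, LinearMap.neg_apply] at h1
    rw [hsymm v, ha, ha]
    simp only [F, LinearMap.sub_apply, LinearMap.add_apply, LinearMap.flip_apply,
      LinearMap.comp_apply]
    rw [h1, hm u v w, hm w v u, hm u w v]
    ring

/-- `exists_koszul_tensor` for continuous multilinear maps. -/
lemma exists_koszul_continuous_tensor {V : Type*} [AddCommGroup V] [Module ℝ V]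
    [TopologicalSpace V] [IsTopologicalAddGroup V] [ContinuousSMul ℝ V] [T2Space V]
    [FiniteDimensional ℝ V] (g : V →L[ℝ] V →L[ℝ] ℝ)
    (hsymm : ∀ v w, g v w = g w v) (hpos : ∀ v, v ≠ 0 → 0 < g v v)
    (T : V →L[ℝ] V →L[ℝ] V) (hT : ∀ u v, T u v = -T v u)
    (m : V →L[ℝ] V →L[ℝ] V →L[ℝ] ℝ) (hm : ∀ v w u, m v w u = m w v u) :
    ∃ a : V →L[ℝ] V →L[ℝ] V, (∀ u v, T u v + a v u - a u v = 0) ∧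
      ∀ v w u, m v w u = g (a v u) w + g v (a w u) := by
  obtain ⟨a, h1, h2⟩ := exists_koszul_tensor
    (LinearMap.mk₂ ℝ (fun v w ↦ g v w) (by simp) (by simp) (by simp) (by simp)) hsymm hpos
    (LinearMap.mk₂ ℝ (fun v w ↦ T v w) (by simp) (by simp) (by simp) (by simp)) hT
    (LinearMap.mk₂ ℝ (fun v w ↦ (m v w).toLinearMap)
      (fun v v' w ↦ LinearMap.ext fun u ↦ congr($(m.map_add v v') w u))
      (fun c v w ↦ LinearMap.ext fun u ↦ congr($(m.map_smul c v) w u))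
      (fun v w w' ↦ LinearMap.ext fun u ↦ congr($((m v).map_add w w') u))
      (fun c v w ↦ LinearMap.ext fun u ↦ congr($((m v).map_smul c w) u)))
    hm
  exact ⟨LinearMap.toContinuousLinearMap (LinearMap.toContinuousLinearMap.toLinearMap ∘ₗ a), h1, h2⟩

end Koszul

/-! ### Existence of the Levi-Civita connection. -/

section LeviCivita

variable {n : ℕ} {M : Type*} [TopologicalSpace M] [ChartedSpace (Model n) M]
  [IsManifold (𝓡 n) ∞ M]

omit [IsManifold (𝓡 n) ∞ M] in
lemma mvfderiv_congr {f f' : M → Model n} {x : M} (h : f =ᶠ[𝓝 x] f') :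
    mvfderiv (𝓡 n) f x = mvfderiv (𝓡 n) f' x := by
  have := h.mfderiv_eq (I := 𝓡 n) (I' := 𝓘(ℝ, Model n))
  exact ContinuousLinearMap.ext fun v ↦ congr($this v)

variable (n M) in
/-- A connection on the tangent bundle: at `x`, differentiate in the preferred trivialization
at `x`. -/
def pointwiseFlatConnection :
    CovariantDerivative (𝓡 n) (Model n) (fun x : M ↦ TangentSpace (𝓡 n) x) where
  toFun σ x := ((trivializationAt (Model n) (fun x : M ↦ TangentSpace (𝓡 n) x) x).symmL ℝ x) ∘L
    (mvfderiv (𝓡 n) (fun y ↦ (trivializationAt (Model n) (fun x : M ↦ TangentSpace (𝓡 n) x) x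
      ⟨y, σ y⟩).2) x)
  isCovariantDerivativeOnUniv := by
    refine ⟨fun {σ σ' x} hσ hσ' _ ↦ ?_, fun {σ f x} hσ hf _ ↦ ?_⟩
    all_goals
      set t := trivializationAt (Model n) (fun x : M ↦ TangentSpace (𝓡 n) x) x
      have hx : x ∈ t.baseSet := mem_baseSet_trivializationAt' x
      have hbs : t.baseSet ∈ 𝓝 x := t.open_baseSet.mem_nhds hx
    · rw [mvfderiv_congr (f' := (fun y ↦ (t ⟨y, σ y⟩).2) + fun y ↦ (t ⟨y, σ' y⟩).2),
        mvfderiv_add ((mdifferentiableAt_section ..).1 hσ) ((mdifferentiableAt_section ..).1 hσ'),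
        ContinuousLinearMap.comp_add]
      filter_upwards [hbs] with y hy
      exact (t.linear ℝ hy).map_add _ _
    · rw [mvfderiv_congr (f' := f • fun y ↦ (t ⟨y, σ y⟩).2),
        mvfderiv_smul hf ((mdifferentiableAt_section ..).1 hσ)]
      · refine ContinuousLinearMap.ext fun v ↦ ?_
        simp only [ContinuousLinearMap.comp_apply, _root_.add_apply,
          _root_.smul_apply, ContinuousLinearMap.smulRight_apply, map_add, map_smul]
        congr 2
        rw [Trivialization.symmL_apply _ hx]
        exact t.symm_apply_apply_mk hx (σ x)
      filter_upwards [hbs] with y hy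
      exact (t.linear ℝ hy).map_smul _ _

/-- Being torsion-free and metric are conditions at each point, and a covariant derivative carries
no regularity in the base point. So any starting connection will do, even one whose trivialization
changes from point to point, and the Koszul correction is chosen separately at each point, without
gluing. -/
theorem exists_isLeviCivita (g : Metric n M) :
    ∃ D : CovariantDerivative (𝓡 n) (Model n) (fun x : M ↦ TangentSpace (𝓡 n) x),
      IsLeviCivita g D := by
  let _ : RiemannianBundle (fun x : M ↦ TangentSpace (𝓡 n) x) := ⟨g.toRiemannianMetric⟩
  let D₀ := pointwiseFlatConnection n M
  have key (x : M) : ∃ a : TangentSpace (𝓡 n) x →L[ℝ] TangentSpace (𝓡 n) x →L[ℝ]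
      TangentSpace (𝓡 n) x, (∀ u v, D₀.torsion x u v + a v u - a u v = 0) ∧
      ∀ v w u, D₀.derivMetricTensor x v w u = g.inner x (a v u) w + g.inner x v (a w u) := by
    refine exists_koszul_continuous_tensor (V := TangentSpace (𝓡 n) x) (g.inner x) (g.symm x)
      (g.pos x) (D₀.torsion x) D₀.torsion_antisymm (D₀.derivMetricTensor x) fun v w u ↦ ?_
    rw [D₀.derivMetricTensor_apply_eq_extend, D₀.derivMetricTensor_apply_eq_extend]
    simp only [real_inner_comm]
    ring
  choose a ha1 ha2 using key
  refine ⟨D₀.addOneForm a, isLeviCivita_iff.2 ⟨fun x X Y hX hY ↦ ?_, fun x X Y Z hX hY hZ ↦ ?_⟩⟩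
  · have h1 := D₀.torsion_apply hX hY
    have h2 := ha1 x (X x) (Y x)
    rw [h1] at h2
    change (D₀ Y x (X x) + a x (Y x) (X x)) - (D₀ X x (Y x) + a x (X x) (Y x)) = _
    rw [← sub_eq_zero, ← h2]
    unfold bracket
    abel
  · have h1 := D₀.derivMetricTensor_apply (X := X) x hY hZ
    have h2 := ha2 x (Y x) (Z x) (X x)
    rw [h1] at h2
    change _ = g.inner x (D₀ Y x (X x) + a x (Y x) (X x)) (Z x)
      + g.inner x (Y x) (D₀ Z x (X x) + a x (Z x) (X x))
    simp only [map_add, _root_.add_apply]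
    have h3 : lieD X (fun y ↦ g.inner y (Y y) (Z y)) x - g.inner x (D₀ Y x (X x)) (Z x)
      - g.inner x (Y x) (D₀ Z x (X x)) = _ := h2
    linarith

end LeviCivita

/-! ### The tensor `∇θ`, and `dη`, `dΩ`, `N_θ` in terms of covariant derivatives. -/

section EndoDerivative

variable {n : ℕ} {M : Type*} [TopologicalSpace M] [ChartedSpace (Model n) M]
  [IsManifold (𝓡 n) ∞ M]

/-- The bilinear map `A` is the covariant derivative of `θ` at `x`: `A v u = (∇_u θ) v`. -/
def IsEndoDerivAt (D : CovariantDerivative (𝓡 n) (Model n) (fun x : M ↦ TangentSpace (𝓡 n) x))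
    (θ : (x : M) → TangentSpace (𝓡 n) x →L[ℝ] TangentSpace (𝓡 n) x) (x : M)
    (A : TangentSpace (𝓡 n) x →ₗ[ℝ] TangentSpace (𝓡 n) x →ₗ[ℝ] TangentSpace (𝓡 n) x) : Prop :=
  ∀ Y : (x : M) → TangentSpace (𝓡 n) x, FieldMDiffAt Y x → ∀ u : TangentSpace (𝓡 n) x,
    D (applyEndo θ Y) x u = A (Y x) u + θ x (D Y x u)

variable {θ : (x : M) → TangentSpace (𝓡 n) x →L[ℝ] TangentSpace (𝓡 n) x}
  {g : Metric n M} {X Y Z ξ : (x : M) → TangentSpace (𝓡 n) x} {x : M}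
  {D : CovariantDerivative (𝓡 n) (Model n) (fun x : M ↦ TangentSpace (𝓡 n) x)}
  {A : TangentSpace (𝓡 n) x →ₗ[ℝ] TangentSpace (𝓡 n) x →ₗ[ℝ] TangentSpace (𝓡 n) x}

lemma covDeriv_add (hX : FieldMDiffAt X x) (hY : FieldMDiffAt Y x) :
    D (X + Y) x = D X x + D Y x :=
  D.isCovariantDerivativeOn.add hX hY

lemma covDeriv_smul {f : M → ℝ} (hf : MDifferentiableAt (𝓡 n) 𝓘(ℝ) f x)
    (hX : FieldMDiffAt X x) (u : TangentSpace (𝓡 n) x) :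
    D (f • X) x u = f x • D X x u + mvfderiv (𝓡 n) f x u • X x := by
  rw [D.isCovariantDerivativeOn.leibniz hX hf]
  rfl

lemma covDeriv_neg (hX : FieldMDiffAt X x) : D (-X) x = -D X x := by
  have := D.isCovariantDerivativeOn.smul_const (x := x) (-1 : ℝ) hX
  rwa [neg_one_smul, neg_one_smul] at this

lemma covDeriv_zero : D 0 x = 0 := D.isCovariantDerivativeOn.zero

/-- The commutator `∇(θY) - θ∇Y` is tensorial in `Y`: the two terms containing the derivative of a
scalar factor cancel. -/
lemma exists_isEndoDerivAt
    (D : CovariantDerivative (𝓡 n) (Model n) (fun x : M ↦ TangentSpace (𝓡 n) x))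
    (hθ : SmoothEndo θ) (x : M) : ∃ A, IsEndoDerivAt D θ x A := by
  let Φ (Y : (x : M) → TangentSpace (𝓡 n) x) : TangentSpace (𝓡 n) x →L[ℝ] TangentSpace (𝓡 n) x :=
    D (applyEndo θ Y) x - (θ x).comp (D Y x)
  have hΦ : TensorialAt (𝓡 n) (Model n) Φ x := by
    constructor
    · intro f σ hf hσ
      refine ContinuousLinearMap.ext fun u ↦ ?_
      have h : applyEndo θ (f • σ) = f • applyEndo θ σ := by
        funext y; simp [applyEndo]
      simp only [Φ, h, _root_.sub_apply, _root_.smul_apply, ContinuousLinearMap.comp_apply,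
        covDeriv_smul hf hσ, covDeriv_smul hf (hθ.mdifferentiableAt_apply hσ),
        map_add, map_smul]
      simp only [applyEndo]
      module
    · intro σ σ' hσ hσ'
      refine ContinuousLinearMap.ext fun u ↦ ?_
      have h : applyEndo θ (σ + σ') = applyEndo θ σ + applyEndo θ σ' := by
        funext y; simp [applyEndo]
      simp only [Φ, h, _root_.sub_apply, ContinuousLinearMap.comp_apply,
        covDeriv_add hσ hσ', covDeriv_add (hθ.mdifferentiableAt_apply hσ)
          (hθ.mdifferentiableAt_apply hσ'), map_add, _root_.add_apply]
      module
  let A := TensorialAt.mkHom Φ x hΦ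
  refine ⟨LinearMap.mk₂ ℝ (fun v u ↦ A v u) (by simp) (by simp) (by simp) (by simp),
    fun Y hY u ↦ ?_⟩
  have h := congr($(TensorialAt.mkHom_apply hΦ hY) u)
  rw [LinearMap.mk₂_apply, show A (Y x) u = _ from h]
  simp

lemma fieldMDiffAt_extend (v : TangentSpace (𝓡 n) x) : FieldMDiffAt (extend (Model n) v) x :=
  mdifferentiableAt_extend ..

/-- Passes from global smooth fields to single tangent vectors; the bump-function extension
`exists_smoothField` is where the Hausdorff property enters. -/
lemma gauge_iff_isEndoDerivAt_zero [T2Space M] (hθ : SmoothEndo θ) :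
    (∀ X Y : (x : M) → TangentSpace (𝓡 n) x, SmoothField X → SmoothField Y →
      ∀ x, D (applyEndo θ Y) x (X x) = θ x (D Y x (X x))) ↔ ∀ x, IsEndoDerivAt D θ x 0 := by
  refine ⟨fun h x ↦ ?_, fun h X Y hX hY x ↦ ?_⟩
  · obtain ⟨A, hA⟩ := exists_isEndoDerivAt D hθ x
    suffices A = 0 from this ▸ hA
    refine LinearMap.ext fun v ↦ LinearMap.ext fun u ↦ ?_
    obtain ⟨X, hX, rfl⟩ := exists_smoothField x u
    obtain ⟨Y, hY, rfl⟩ := exists_smoothField x v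
    have h1 := hA Y (hY.mdifferentiableAt x) (X x)
    rw [h X Y hX hY x] at h1
    simpa using h1
  · simpa using h x Y (hY.mdifferentiableAt x) (X x)

/-- Differentiate `g(θY, Z) = -g(Y, θZ)`; the terms with `∇Y` and `∇Z` cancel by skewness of `θ`
itself. -/
lemma IsLeviCivita.inner_deriv_skew (hD : IsLeviCivita g D) (hθ : SmoothEndo θ) (hs : IsSkew g θ)
    (hA : IsEndoDerivAt D θ x A) (u v w : TangentSpace (𝓡 n) x) :
    g.inner x (A v u) w = -g.inner x v (A w u) := by
  obtain ⟨-, hm⟩ := isLeviCivita_iff.1 hD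
  have hu := fieldMDiffAt_extend u
  have hv := fieldMDiffAt_extend v
  have hw := fieldMDiffAt_extend w
  have h1 := hm x _ _ _ hu (hθ.mdifferentiableAt_apply hv) hw
  have h2 := hm x _ _ _ hu hv (hθ.mdifferentiableAt_apply hw)
  have h3 : (fun y ↦ g.inner y (applyEndo θ (extend (Model n) v) y) (extend (Model n) w y)) =
      -fun y ↦ g.inner y (extend (Model n) v y) (applyEndo θ (extend (Model n) w) y) :=
    funext fun y ↦ hs y _ _
  have h4 : lieD (extend (Model n) u) (-fun y ↦ g.inner y (extend (Model n) v y)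
      (applyEndo θ (extend (Model n) w) y)) x = -lieD (extend (Model n) u)
      (fun y ↦ g.inner y (extend (Model n) v y) (applyEndo θ (extend (Model n) w) y)) x := by
    unfold lieD
    rw [mvfderiv_neg]
    rfl
  rw [h3, h4, h2, hA _ hv, hA _ hw] at h1
  simp only [applyEndo, extend_apply_self, map_add, _root_.add_apply] at h1
  rw [hs] at h1
  have h5 := hs x v (D (extend (Model n) w) x u)
  have h6 := hs x (D (extend (Model n) v) x u) w
  linarith

lemma IsLeviCivita.dOne_inner (hD : IsLeviCivita g D) (hξ : FieldMDiffAt ξ x)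
    (hX : FieldMDiffAt X x) (hY : FieldMDiffAt Y x) :
    dOne (fun y ↦ g.inner y (ξ y)) X Y x =
      g.inner x (D ξ x (X x)) (Y x) - g.inner x (D ξ x (Y x)) (X x) := by
  obtain ⟨ht, hm⟩ := isLeviCivita_iff.1 hD
  unfold dOne
  rw [hm x X ξ Y hX hξ hY, hm x Y ξ X hY hξ hX, ← ht x X Y hX hY, map_sub]
  ring

/-- For a torsion-free connection `dΩ` is the cyclic sum of `∇Ω`, and metric compatibility gives
`(∇_u Ω)(v, w) = g(v, (∇_u θ) w)`. -/
lemma IsLeviCivita.dTwo_fundamental (hD : IsLeviCivita g D) (hθ : SmoothEndo θ)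
    (hs : IsSkew g θ) (hA : IsEndoDerivAt D θ x A)
    (hX : FieldMDiffAt X x) (hY : FieldMDiffAt Y x) (hZ : FieldMDiffAt Z x) :
    dTwo (fun y v w ↦ g.inner y v (θ y w)) X Y Z x =
      g.inner x (Y x) (A (Z x) (X x)) - g.inner x (X x) (A (Z x) (Y x))
        + g.inner x (X x) (A (Y x) (Z x)) := by
  obtain ⟨ht, hm⟩ := isLeviCivita_iff.1 hD
  have hθY := hθ.mdifferentiableAt_apply hY
  have hθZ := hθ.mdifferentiableAt_apply hZ
  have h1 := hm x X Y _ hX hY hθZ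
  have h2 := hm x Y X _ hY hX hθZ
  have h3 := hm x Z X _ hZ hX hθY
  rw [hA _ hZ] at h1 h2
  rw [hA _ hY] at h3
  unfold dTwo
  simp only [applyEndo] at h1 h2 h3
  rw [h1, h2, h3, ← ht x X Y hX hY, ← ht x X Z hX hZ, ← ht x Y Z hY hZ]
  have hs' (v w) : g.inner x v (θ x w) = -g.inner x w (θ x v) := by
    rw [← hs, g.symm]
  simp only [map_add, map_sub, _root_.sub_apply]
  rw [hs' (Y x) (D Z x (X x)), hs' (X x) (D Z x (Y x)), hs' (X x) (D Y x (Z x))]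
  simp only [hs' (D _ x _)]
  ring

lemma IsLeviCivita.nijenhuis_eq (hD : IsLeviCivita g D) (hθ : SmoothEndo θ)
    (hA : IsEndoDerivAt D θ x A) (hX : FieldMDiffAt X x) (hY : FieldMDiffAt Y x) :
    nijenhuis θ X Y x = A (Y x) (θ x (X x)) - A (X x) (θ x (Y x))
      + θ x (A (X x) (Y x)) - θ x (A (Y x) (X x)) := by
  obtain ⟨ht, -⟩ := isLeviCivita_iff.1 hD
  have hθX := hθ.mdifferentiableAt_apply hX
  have hθY := hθ.mdifferentiableAt_apply hY
  unfold nijenhuis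
  rw [← ht x _ _ hX hY, ← ht x _ _ hθX hY, ← ht x _ _ hX hθY, ← ht x _ _ hθX hθY]
  simp only [hA _ hX, hA _ hY, applyEndo, map_add, map_sub]
  abel

end EndoDerivative

/-! ### Skew endomorphisms of a Euclidean 3-space. -/

section LinearAlgebra

variable {V : Type*} [AddCommGroup V] [Module ℝ V] {g : LinearMap.BilinForm ℝ V}
  {θ : V →ₗ[ℝ] V}

lemma eq_of_forall_bilin_eq (hpos : ∀ v, v ≠ 0 → 0 < g v v) {v w : V}
    (h : ∀ z, g v z = g w z) : v = w := by
  rw [← sub_eq_zero]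
  by_contra h0
  exact (hpos _ h0).ne' (by rw [map_sub g, LinearMap.sub_apply, h, sub_self])

/-- A unit vector of a Euclidean 3-space is part of an orthonormal frame. -/
lemma exists_orthonormal_frame (hV : Module.finrank ℝ V = 3) (hsymm : ∀ v w, g v w = g w v)
    (hpos : ∀ v, v ≠ 0 → 0 < g v v) {n : V} (hn : g n n = 1) :
    ∃ e₁ e₂ : V, g e₁ e₁ = 1 ∧ g e₂ e₂ = 1 ∧ g e₁ e₂ = 0 ∧ g e₁ n = 0 ∧ g e₂ n = 0 ∧
      ∀ v, v = g v e₁ • e₁ + g v e₂ • e₂ + g v n • n := by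
  let c : InnerProductSpace.Core ℝ V :=
    { inner v w := g v w
      conj_inner_symm v w := by simp [hsymm v w]
      re_inner_nonneg v := by
        by_cases h : v = 0
        · simp [h]
        · exact (hpos v h).le
      add_left := by simp
      smul_left := by simp
      definite v h := by
        by_contra h0
        exact (hpos v h0).ne' h }
  let _ : NormedAddCommGroup V := c.toNormedAddCommGroup
  let _ : InnerProductSpace ℝ V := InnerProductSpace.ofCore c.toCore
  have : FiniteDimensional ℝ V := FiniteDimensional.of_finrank_pos (by omega)
  have hg (v w : V) : inner ℝ v w = g v w := rfl
  have hn' : ‖n‖ = 1 := by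
    rw [← sq_eq_sq₀ (norm_nonneg _) zero_le_one, ← real_inner_self_eq_norm_sq, hg, hn, one_pow]
  -- The vector `n` is prescribed at index 2, so the other two basis vectors span its orthogonal
  -- plane.
  obtain ⟨b, hb⟩ := Orthonormal.exists_orthonormalBasis_extension_of_card_eq (𝕜 := ℝ) (ι := Fin 3)
    (by simp [hV]) (v := fun _ ↦ n) (s := {2}) (by
      refine ⟨fun i ↦ hn', fun i j hij ↦ (hij (Subsingleton.elim i j)).elim⟩)
  have hb2 : b 2 = n := hb 2 rfl
  have ho (i j : Fin 3) : g (b i) (b j) = if i = j then 1 else 0 := by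
    rw [← hg, orthonormal_iff_ite.1 b.orthonormal]
  refine ⟨b 0, b 1, ?_, ?_, ?_, ?_, ?_, fun v ↦ ?_⟩
  · simp [ho]
  · simp [ho]
  · simp [ho]
  · simp [← hb2, ho]
  · simp [← hb2, ho]
  · have := b.sum_repr' v
    simp only [Fin.sum_univ_three, hg, hsymm _ v, hb2] at this
    exact this.symm

/-- In dimension 3, a skew-symmetric endomorphism killing a unit vector `n` is an infinitesimal
rotation about `n`. -/
lemma exists_rotation_frame (hV : Module.finrank ℝ V = 3) (hsymm : ∀ v w, g v w = g w v)
    (hpos : ∀ v, v ≠ 0 → 0 < g v v) {n : V} (hn : g n n = 1)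
    (hθ : ∀ v w, g (θ v) w = -g v (θ w)) (hθn : θ n = 0) :
    ∃ (e₁ e₂ : V) (c : ℝ), g e₁ e₁ = 1 ∧ g e₂ e₂ = 1 ∧ g e₁ e₂ = 0 ∧ g e₁ n = 0 ∧ g e₂ n = 0 ∧
      (∀ v, v = g v e₁ • e₁ + g v e₂ • e₂ + g v n • n) ∧ θ e₁ = c • e₂ ∧ θ e₂ = -c • e₁ := by
  obtain ⟨e₁, e₂, h11, h22, h12, h1n, h2n, hv⟩ := exists_orthonormal_frame hV hsymm hpos hn
  have hself (v : V) : g (θ v) v = 0 := by linarith [hθ v v, hsymm (θ v) v]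
  have hn0 (v : V) : g (θ v) n = 0 := by rw [hθ, hθn]; simp
  refine ⟨e₁, e₂, g (θ e₁) e₂, h11, h22, h12, h1n, h2n, hv, ?_, ?_⟩
  · conv_lhs => rw [hv (θ e₁), hself, hn0]
    simp
  · conv_lhs => rw [hv (θ e₂), hself, hn0, hθ e₂ e₁, hsymm e₂]
    simp

/-- The vector dual to the `2`-form `g(·, θ·)` in the basis `b`. -/
def axisVector (g : LinearMap.BilinForm ℝ V) (θ : V →ₗ[ℝ] V) (b : Fin 3 → V) : V :=
  g (b 1) (θ (b 2)) • b 0 + g (b 2) (θ (b 0)) • b 1 + g (b 0) (θ (b 1)) • b 2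

/-- The axis vector is the contraction of the trivector `b 0 ∧ b 1 ∧ b 2` with the 2-form `g(·,
θ·)`, and the trivector scales by the determinant. Once normalized, only the sign of the determinant
matters. -/
lemma axisVector_change (hsymm : ∀ v w, g v w = g w v) (hθ : ∀ v w, g (θ v) w = -g v (θ w))
    {b b' : Fin 3 → V} {P : Matrix (Fin 3) (Fin 3) ℝ} (hP : ∀ i, b' i = ∑ j, P i j • b j) :
    axisVector g θ b' = P.det • axisVector g θ b := by
  have hself (v : V) : g v (θ v) = 0 := by linarith [hθ v v, hsymm (θ v) v]
  have h10 : g (b 1) (θ (b 0)) = -g (b 0) (θ (b 1)) := by rw [← hθ, hsymm]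
  have h21 : g (b 2) (θ (b 1)) = -g (b 1) (θ (b 2)) := by rw [← hθ, hsymm]
  have h02 : g (b 0) (θ (b 2)) = -g (b 2) (θ (b 0)) := by rw [← hθ, hsymm]
  simp only [axisVector, hP, Fin.sum_univ_three, map_add, map_smul, LinearMap.add_apply,
    LinearMap.smul_apply, hself, h10, h21, h02, Matrix.det_fin_three, smul_eq_mul]
  match_scalars <;> ring

/-- The three independent entries of a skew 3×3 matrix, suitably ordered and signed, form a vector
in its kernel. The basis need not be orthonormal, as the matrix is that of the 2-form. -/
lemma endo_axisVector (hsymm : ∀ v w, g v w = g w v)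
    (hpos : ∀ v, v ≠ 0 → 0 < g v v) (hθ : ∀ v w, g (θ v) w = -g v (θ w))
    (b : Module.Basis (Fin 3) ℝ V) : θ (axisVector g θ b) = 0 := by
  have hself (v : V) : g v (θ v) = 0 := by linarith [hθ v v, hsymm (θ v) v]
  have h10 : g (b 1) (θ (b 0)) = -g (b 0) (θ (b 1)) := by rw [← hθ, hsymm]
  have h21 : g (b 2) (θ (b 1)) = -g (b 1) (θ (b 2)) := by rw [← hθ, hsymm]
  have h02 : g (b 0) (θ (b 2)) = -g (b 2) (θ (b 0)) := by rw [← hθ, hsymm]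
  refine eq_of_forall_bilin_eq hpos fun z ↦ ?_
  rw [map_zero, LinearMap.zero_apply, hsymm]
  suffices g.flip (θ (axisVector g θ b)) = 0 from congr($this z)
  refine b.ext fun i ↦ ?_
  fin_cases i <;>
  · simp [axisVector, hself, h10, h21, h02]
    try ring

lemma axisVector_ne_zero (hsymm : ∀ v w, g v w = g w v)
    (hpos : ∀ v, v ≠ 0 → 0 < g v v) (hθ : ∀ v w, g (θ v) w = -g v (θ w))
    (b : Module.Basis (Fin 3) ℝ V) (h0 : θ ≠ 0) : axisVector g θ b ≠ 0 := by
  intro h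
  have hself (v : V) : g v (θ v) = 0 := by linarith [hθ v v, hsymm (θ v) v]
  have h10 : g (b 1) (θ (b 0)) = -g (b 0) (θ (b 1)) := by rw [← hθ, hsymm]
  have h21 : g (b 2) (θ (b 1)) = -g (b 1) (θ (b 2)) := by rw [← hθ, hsymm]
  have h02 : g (b 0) (θ (b 2)) = -g (b 2) (θ (b 0)) := by rw [← hθ, hsymm]
  have hi := Fintype.linearIndependent_iff.1 b.linearIndependent
    ![g (b 1) (θ (b 2)), g (b 2) (θ (b 0)), g (b 0) (θ (b 1))] (by
      simpa [Fin.sum_univ_three, axisVector] using h)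
  have h12 : g (b 1) (θ (b 2)) = 0 := hi 0
  have h20 : g (b 2) (θ (b 0)) = 0 := hi 1
  have h01 : g (b 0) (θ (b 1)) = 0 := hi 2
  refine h0 (b.ext fun i ↦ eq_of_forall_bilin_eq hpos fun z ↦ ?_)
  simp only [LinearMap.zero_apply, map_zero]
  suffices g (θ (b i)) = 0 from congr($this z)
  refine b.ext fun j ↦ ?_
  rw [hsymm]
  fin_cases i <;> fin_cases j <;> simp [hself, h10, h21, h02, h12, h20, h01]

/-- Minus half the trace of `θ²`: the squared rotation speed of a skew endomorphism. -/
def speedSq (θ : V →ₗ[ℝ] V) : ℝ := -2⁻¹ * LinearMap.trace ℝ V (θ ∘ₗ θ)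

/-- On the plane `n⊥`, `θ` is a quarter turn times some `c`, so `θ²` is `-c²` there and has trace
`-2c²`. The trace expresses `c²` without choosing a frame. -/
lemma sq_eq_speedSq_smul (hV : Module.finrank ℝ V = 3) (hsymm : ∀ v w, g v w = g w v)
    (hpos : ∀ v, v ≠ 0 → 0 < g v v) {n : V} (hn : g n n = 1)
    (hθ : ∀ v w, g (θ v) w = -g v (θ w)) (hθn : θ n = 0) :
    0 ≤ speedSq θ ∧ ∀ v, θ (θ v) = speedSq θ • (-v + g n v • n) := by
  have : FiniteDimensional ℝ V := FiniteDimensional.of_finrank_pos (by omega)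
  obtain ⟨e₁, e₂, c, -, -, -, -, -, hv, h1, h2⟩ := exists_rotation_frame hV hsymm hpos hn hθ hθn
  have key (v : V) : θ (θ v) = c ^ 2 • (-v + g n v • n) := by
    have e := hv v
    have h3 : θ (θ v) = -c ^ 2 • (g v e₁ • e₁ + g v e₂ • e₂) := by
      conv_lhs => rw [e]
      simp only [map_add, map_smul, h1, h2, hθn, map_zero]
      module
    rw [h3, hsymm n, ← sub_eq_iff_eq_add.2 e]
    module
  suffices speedSq θ = c ^ 2 from ⟨this ▸ sq_nonneg c, this ▸ key⟩
  have h3 : θ ∘ₗ θ = c ^ 2 • (-LinearMap.id + (g n).smulRight n) := LinearMap.ext key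
  have h4 : LinearMap.trace ℝ V ((g n).smulRight n) = g n n := by
    simp
  rw [speedSq, h3, map_smul, map_add, map_neg, LinearMap.trace_id, h4, hV, hn]
  norm_num
  ring

lemma exists_unit_kernel (hV : Module.finrank ℝ V = 3) (hsymm : ∀ v w, g v w = g w v)
    (hpos : ∀ v, v ≠ 0 → 0 < g v v) (hθ : ∀ v w, g (θ v) w = -g v (θ w)) :
    ∃ n, g n n = 1 ∧ θ n = 0 := by
  have : FiniteDimensional ℝ V := FiniteDimensional.of_finrank_pos (by omega)
  let b := Module.finBasisOfFinrankEq ℝ V hV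
  obtain ⟨v, hv, hθv⟩ : ∃ v, v ≠ 0 ∧ θ v = 0 := by
    by_cases h0 : θ = 0
    · exact ⟨b 0, b.ne_zero 0, by simp [h0]⟩
    · exact ⟨_, axisVector_ne_zero hsymm hpos hθ b h0, endo_axisVector hsymm hpos hθ b⟩
  have hp := hpos v hv
  refine ⟨(√(g v v))⁻¹ • v, ?_, by simp [hθv]⟩
  have := Real.mul_self_sqrt hp.le
  have h1 : √(g v v) ≠ 0 := (Real.sqrt_pos.2 hp).ne'
  simp only [map_smul, LinearMap.smul_apply, smul_eq_mul]
  field_simp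
  rw [sq, this]

lemma speedSq_nonneg (hV : Module.finrank ℝ V = 3) (hsymm : ∀ v w, g v w = g w v)
    (hpos : ∀ v, v ≠ 0 → 0 < g v v) (hθ : ∀ v w, g (θ v) w = -g v (θ w)) : 0 ≤ speedSq θ := by
  obtain ⟨n, hn, hθn⟩ := exists_unit_kernel hV hsymm hpos hθ
  exact (sq_eq_speedSq_smul hV hsymm hpos hn hθ hθn).1

lemma speedSq_pos (hV : Module.finrank ℝ V = 3) (hsymm : ∀ v w, g v w = g w v)
    (hpos : ∀ v, v ≠ 0 → 0 < g v v) (hθ : ∀ v w, g (θ v) w = -g v (θ w)) (h0 : θ ≠ 0) :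
    0 < speedSq θ := by
  obtain ⟨n, hn, hθn⟩ := exists_unit_kernel hV hsymm hpos hθ
  obtain ⟨h1, h2⟩ := sq_eq_speedSq_smul hV hsymm hpos hn hθ hθn
  refine lt_of_le_of_ne h1 fun h ↦ h0 (LinearMap.ext fun v ↦ ?_)
  by_contra hv
  exact (hpos _ hv).ne' (by rw [hθ, h2, ← h]; simp)

/-- This form of the rotation identity does not mention the axis, so it can be differentiated before
a smooth axis is known to exist. -/
lemma cube_eq_neg_speedSq_smul (hV : Module.finrank ℝ V = 3) (hsymm : ∀ v w, g v w = g w v)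
    (hpos : ∀ v, v ≠ 0 → 0 < g v v) (hθ : ∀ v w, g (θ v) w = -g v (θ w)) (v : V) :
    θ (θ (θ v)) = -speedSq θ • θ v := by
  obtain ⟨n, hn, hθn⟩ := exists_unit_kernel hV hsymm hpos hθ
  rw [(sq_eq_speedSq_smul hV hsymm hpos hn hθ hθn).2, hsymm, hθ, hθn]
  simp

/-- The pointwise algebra showing that a coKähler structure in dimension 3 is parallel: `A` stands
for `∇θ` and `b` for `∇ξ`. -/
lemma endoDeriv_eq_zero (hV : Module.finrank ℝ V = 3) (hsymm : ∀ v w, g v w = g w v)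
    (hpos : ∀ v, v ≠ 0 → 0 < g v v) (hθ : ∀ v w, g (θ v) w = -g v (θ w)) {ξ : V}
    (hξ : g ξ ξ = 1) (hθξ : θ ξ = 0) (hsq : ∀ v, θ (θ v) = -v + g ξ v • ξ)
    {A : V →ₗ[ℝ] V →ₗ[ℝ] V} {b : V →ₗ[ℝ] V} (hAs : ∀ u v w, g (A v u) w = -g v (A w u))
    (hAξ : ∀ u, A ξ u = -θ (b u)) (hbξ : ∀ u, g (b u) ξ = 0)
    (hAθ : ∀ u v, A (θ v) u + θ (A v u) = g (b u) v • ξ + g ξ v • b u)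
    (hη : ∀ u v, g (b u) v = g (b v) u)
    (hN : ∀ u v, A v (θ u) - A u (θ v) + θ (A u v) - θ (A v u) = 0)
    (hΩ : ∀ u v w, g v (A w u) - g u (A w v) + g u (A v w) = 0) : A = 0 := by
  obtain ⟨e, e', c, hee, he'e', hee', heξ, he'ξ, hv, hθe, hθe'⟩ :=
    exists_rotation_frame hV hsymm hpos hξ hθ hθξ
  have hc : c ^ 2 = 1 := by
    have := congrArg (fun v ↦ g v e) (hsq e)
    simp only [hθe, map_smul, hθe', hsymm ξ, heξ, zero_smul, add_zero, map_neg, hee,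
      LinearMap.smul_apply, LinearMap.neg_apply, smul_eq_mul] at this
    linarith
  have hc0 : c ≠ 0 := by
    rintro rfl
    norm_num at hc
  have hbξ0 : b ξ = 0 := eq_of_forall_bilin_eq hpos fun z ↦ by rw [hη, hbξ]; simp
  -- In dimension 3, `∇θ` has no component in the contact plane.
  have hplane (u : V) : g (A e u) e' = 0 := by
    have h1 := congrArg (fun v ↦ g v e) (hAθ u e)
    simp only [hθe, map_smul, map_add, hθ, LinearMap.add_apply, LinearMap.smul_apply, smul_eq_mul,
      hsymm ξ, heξ, mul_zero, zero_smul, add_zero] at h1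
    have h2 : g (A e' u) e = -g (A e u) e' := by rw [hAs, hsymm e']
    simp only [h2] at h1
    have h3 : c * g (A e u) e' = 0 := by linarith
    exact (mul_eq_zero.1 h3).resolve_left hc0
  have hself (u v : V) : g (A v u) v = 0 := by linarith [hAs u v v, hsymm (A v u) v]
  -- The planar part of `A · u` vanishes and the rest is `A ξ u = -θ (b u)` and its skew
  -- counterpart, so `b u` controls all of it.
  have hAb (u : V) (hu : b u = 0) (v : V) : A v u = 0 := by
    have h0 : A ξ u = 0 := by rw [hAξ, hu, map_zero, neg_zero]
    have hn (w : V) : g (A w u) ξ = 0 := by rw [hAs, h0, map_zero, neg_zero]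
    have h1 : A e u = 0 := by rw [hv (A e u), hself, hplane, hn]; simp
    have h2 : A e' u = 0 := by rw [hv (A e' u), hself, hAs, h1, hn]; simp
    rw [hv v]
    simp [h0, h1, h2]
  have hcomm (u : V) : b (θ u) = θ (b u) := by
    -- Normality is needed only against `ξ`, where it reads `θ b θ u = -b u`; applying `θ` once more
    -- gives commutation.
    have h1 := hN u ξ
    rw [hAξ, hθξ, hAξ, map_zero, hAb ξ hbξ0, map_zero, map_neg, hsq (b u), hsymm ξ, hbξ] at h1
    have h2 := congrArg θ h1
    simp only [map_sub, map_neg, map_zero, hsq (b (θ u)), hsymm ξ, hbξ, zero_smul,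
      add_zero, sub_zero] at h2
    rw [← sub_eq_zero, ← h2]
    abel
  have hp (v : V) : c * g (b e') v = -g (b e) (θ v) := by
    rw [← hθ, ← hcomm, hθe, map_smul, map_smul, LinearMap.smul_apply, smul_eq_mul]
  have h1 := hp e'
  have h2 := hp e
  -- This value of `dΩ` is, up to the factor `c`, the trace of `b` on the plane; a symmetric
  -- trace-free `b` commuting with the quarter turn is zero.
  have h3 := hΩ e e' ξ
  rw [hAb ξ hbξ0, hAξ, hAξ] at h3
  simp only [map_neg, map_zero, ← hcomm, hθe, hθe', map_smul, smul_eq_mul] at h1 h2 h3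
  rw [hsymm e', hsymm e] at h3
  have h4 := hη e e'
  have hbee' : g (b e) e' = 0 := by
    have : c * g (b e) e' = 0 := by linear_combination (h2 + c * h4) / 2
    exact (mul_eq_zero.1 this).resolve_left hc0
  have hbee : g (b e) e = 0 := by
    have : c * g (b e) e = 0 := by linear_combination -(h1 + h3) / 2
    exact (mul_eq_zero.1 this).resolve_left hc0
  have hbe'e' : g (b e') e' = 0 := by
    have : c * g (b e') e' = 0 := by linear_combination (h1 - h3) / 2
    exact (mul_eq_zero.1 this).resolve_left hc0
  have hb (u : V) : b u = 0 := by
    have h5 : b e = 0 := by rw [hv (b e), hbee, hbee', hbξ]; simp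
    have h6 : b e' = 0 := by rw [hv (b e'), ← h4, hbee', hbe'e', hbξ]; simp
    rw [hv u]
    simp [h5, h6, hbξ0]
  exact LinearMap.ext fun v ↦ LinearMap.ext fun u ↦ hAb u (hb u) v

end LinearAlgebra

/-! ### Identities of almost contact metric structures and their derivatives. -/

section Parallel

variable {n : ℕ} {M : Type*} [TopologicalSpace M] [ChartedSpace (Model n) M]
  [IsManifold (𝓡 n) ∞ M]

/-- The metric at a point as a bilinear form. -/
def Metric.bilin (g : Metric n M) (x : M) : LinearMap.BilinForm ℝ (TangentSpace (𝓡 n) x) :=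
  LinearMap.mk₂ ℝ (fun v w ↦ g.inner x v w) (by simp) (by simp) (by simp) (by simp)

lemma Metric.bilin_pos (g : Metric n M) (x : M) (v : TangentSpace (𝓡 n) x) (hv : v ≠ 0) :
    0 < g.bilin x v v := g.pos x v hv

lemma Metric.bilin_symm (g : Metric n M) (x : M) (v w : TangentSpace (𝓡 n) x) :
    g.bilin x v w = g.bilin x w v := g.symm x v w

section AlmostContact

variable (S : AlmostContactMetric n M) (x : M)

lemma AlmostContactMetric.θ_ξ : S.θ x (S.ξ x) = 0 := by
  have h1 : S.θ x (S.θ x (S.ξ x)) = 0 := by simp [S.θ_sq, S.η_ξ]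
  have h2 := S.θ_sq x (S.θ x (S.ξ x))
  rw [h1, map_zero] at h2
  have h3 : S.θ x (S.ξ x) = S.η x (S.θ x (S.ξ x)) • S.ξ x :=
    neg_add_eq_zero.1 h2.symm
  rw [h3, map_smul] at h1
  rcases smul_eq_zero.1 h1 with h | h
  · rw [h3, h, zero_smul]
  · exact h

lemma AlmostContactMetric.η_θ (v : TangentSpace (𝓡 n) x) : S.η x (S.θ x v) = 0 := by
  have h1 := S.θ_sq x (S.θ x v)
  have h2 := congrArg (S.θ x) (S.θ_sq x v)
  rw [map_add, map_smul, S.θ_ξ, smul_zero, add_zero, map_neg, h1] at h2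
  have h3 := congrArg (S.η x) (add_eq_left.1 h2)
  simpa [S.η_ξ] using h3

lemma AlmostContactMetric.inner_ξ (v : TangentSpace (𝓡 n) x) : S.g.inner x (S.ξ x) v = S.η x v := by
  have h := S.adapted x (S.ξ x) v
  rw [S.θ_ξ, S.η_ξ, map_zero, one_mul] at h
  have h' : (0 : ℝ) = S.g.inner x (S.ξ x) v - S.η x v := h
  linarith

/-- Apply compatibility of `g` to `θv` and `w`, and expand `θ²v`; the `η` terms drop out because `η
∘ θ = 0`. -/
lemma AlmostContactMetric.isSkew : IsSkew S.g S.θ := fun x v w ↦ by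
  have h := S.adapted x (S.θ x v) w
  rw [S.θ_sq, S.η_θ, zero_mul, sub_zero, map_add, map_neg, map_smul] at h
  simp only [_root_.add_apply, _root_.neg_apply, _root_.smul_apply, S.inner_ξ, S.η_θ,
    smul_zero, add_zero] at h
  exact h.symm

variable {S x} {D : CovariantDerivative (𝓡 n) (Model n) (fun x : M ↦ TangentSpace (𝓡 n) x)}
  {A : TangentSpace (𝓡 n) x →ₗ[ℝ] TangentSpace (𝓡 n) x →ₗ[ℝ] TangentSpace (𝓡 n) x}

lemma AlmostContactMetric.endoDeriv_ξ (hA : IsEndoDerivAt D S.θ x A) (u : TangentSpace (𝓡 n) x) :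
    A (S.ξ x) u = -S.θ x (D S.ξ x u) := by
  have h := hA S.ξ (S.smooth_ξ.mdifferentiableAt x) u
  rw [show applyEndo S.θ S.ξ = 0 from funext fun y ↦ S.θ_ξ y, covDeriv_zero] at h
  exact eq_neg_of_add_eq_zero_left h.symm

lemma AlmostContactMetric.inner_D_ξ (hD : IsLeviCivita S.g D) (u : TangentSpace (𝓡 n) x) :
    S.g.inner x (D S.ξ x u) (S.ξ x) = 0 := by
  have hξ := S.smooth_ξ.mdifferentiableAt x
  have h := (isLeviCivita_iff.1 hD).2 x _ _ _ (fieldMDiffAt_extend u) hξ hξ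
  rw [show (fun y ↦ S.g.inner y (S.ξ y) (S.ξ y)) = fun _ ↦ 1 from
    funext fun y ↦ by rw [S.inner_ξ, S.η_ξ], S.g.symm x (S.ξ x)] at h
  unfold lieD at h
  rw [mvfderiv_const] at h
  simp only [extend_apply_self] at h
  have h' : (0 : ℝ) = _ := h
  linarith

/-- The derivative of `θ² = -Id + η ⊗ ξ`, with `η = g(ξ, ·)`. -/
lemma AlmostContactMetric.endoDeriv_θ (hD : IsLeviCivita S.g D) (hA : IsEndoDerivAt D S.θ x A)
    (u v : TangentSpace (𝓡 n) x) : A (S.θ x v) u + S.θ x (A v u) =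
      S.g.inner x (D S.ξ x u) v • S.ξ x + S.g.inner x (S.ξ x) v • D S.ξ x u := by
  have hξ := S.smooth_ξ.mdifferentiableAt x
  have hv := fieldMDiffAt_extend v
  have hf := mdifferentiableAt_inner S.g hξ hv
  set Y := extend (Model n) v
  have hY : Y x = v := extend_apply_self ..
  have h1 : applyEndo S.θ (applyEndo S.θ Y) =
      -Y + (fun y ↦ S.g.inner y (S.ξ y) (Y y)) • S.ξ := funext fun y ↦ by
    simp [applyEndo, S.θ_sq, S.inner_ξ]
  have h2 := hA _ (S.smooth_θ.mdifferentiableAt_apply hv) u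
  have h3 := (isLeviCivita_iff.1 hD).2 x _ _ _ (fieldMDiffAt_extend u) hξ hv
  have h4 : FieldMDiffAt (-Y) x := mdifferentiableAt_neg_section hv
  unfold lieD at h3
  simp only [extend_apply_self] at h3
  rw [hA _ hv, h1, covDeriv_add h4 (hf.smul_section hξ), _root_.add_apply,
    covDeriv_smul hf hξ, covDeriv_neg hv, h3, map_add, S.θ_sq,
    ← S.inner_ξ] at h2
  simp only [applyEndo, hY, _root_.neg_apply] at h2
  rw [← sub_eq_zero] at h2 ⊢
  refine Eq.trans ?_ (neg_eq_zero.2 h2)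
  module

end AlmostContact

end Parallel

/-! ### A coKähler structure in dimension 3 is parallel. -/

section ThreeDim

variable {M : Type*} [TopologicalSpace M] [T2Space M] [ChartedSpace (Model 3) M]
  [IsManifold (𝓡 3) ∞ M]

lemma AlmostContactMetric.IsCoKahler.endoDeriv_eq_zero {S : AlmostContactMetric 3 M}
    (hS : S.IsCoKahler)
    {D : CovariantDerivative (𝓡 3) (Model 3) (fun x : M ↦ TangentSpace (𝓡 3) x)}
    (hD : IsLeviCivita S.g D) {x : M}
    {A : TangentSpace (𝓡 3) x →ₗ[ℝ] TangentSpace (𝓡 3) x →ₗ[ℝ] TangentSpace (𝓡 3) x}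
    (hA : IsEndoDerivAt D S.θ x A) : A = 0 := by
  obtain ⟨⟨hη, hΩ⟩, hN⟩ := hS
  have hξ := S.smooth_ξ.mdifferentiableAt x
  refine CoKahler.endoDeriv_eq_zero (g := S.g.bilin x) (θ := (S.θ x).toLinearMap) (ξ := S.ξ x)
    (b := (D S.ξ x).toLinearMap) (finrank_tangentSpace x) (S.g.bilin_symm x) (S.g.bilin_pos x)
    (S.isSkew x) ?_ (S.θ_ξ x) (fun v ↦ ?_) (hD.inner_deriv_skew S.smooth_θ S.isSkew hA)
    (S.endoDeriv_ξ hA) (S.inner_D_ξ hD) (S.endoDeriv_θ hD hA) ?_ ?_ ?_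
  · exact (S.inner_ξ x _).trans (S.η_ξ x)
  · exact (S.θ_sq x v).trans congr(-v + $((S.inner_ξ x v).symm) • S.ξ x)
  · intro u v
    obtain ⟨X, hX, rfl⟩ := exists_smoothField x u
    obtain ⟨Y, hY, rfl⟩ := exists_smoothField x v
    have h := hη X Y hX hY x
    rw [show S.η = fun y ↦ S.g.inner y (S.ξ y) from
      funext fun y ↦ ContinuousLinearMap.ext fun v ↦ (S.inner_ξ y v).symm,
      hD.dOne_inner hξ (hX.mdifferentiableAt x) (hY.mdifferentiableAt x)] at h
    exact sub_eq_zero.1 h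
  · intro u v
    obtain ⟨X, hX, rfl⟩ := exists_smoothField x u
    obtain ⟨Y, hY, rfl⟩ := exists_smoothField x v
    have h := hN X Y hX hY x
    rw [hη X Y hX hY, zero_smul, add_zero, hD.nijenhuis_eq S.smooth_θ hA (hX.mdifferentiableAt x)
      (hY.mdifferentiableAt x)] at h
    exact h
  · intro u v w
    obtain ⟨X, hX, rfl⟩ := exists_smoothField x u
    obtain ⟨Y, hY, rfl⟩ := exists_smoothField x v
    obtain ⟨Z, hZ, rfl⟩ := exists_smoothField x w
    have h := hΩ X Y Z hX hY hZ x
    exact (hD.dTwo_fundamental S.smooth_θ S.isSkew hA (hX.mdifferentiableAt x)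
      (hY.mdifferentiableAt x) (hZ.mdifferentiableAt x)).symm.trans h

theorem AlmostContactMetric.IsCoKahler.solvesGauge {S : AlmostContactMetric 3 M}
    (hS : S.IsCoKahler) : SolvesGauge S.g S.θ := by
  obtain ⟨D, hD⟩ := exists_isLeviCivita S.g
  refine ⟨D, hD, (gauge_iff_isEndoDerivAt_zero S.smooth_θ).2 fun x ↦ ?_⟩
  obtain ⟨A, hA⟩ := exists_isEndoDerivAt D S.smooth_θ x
  exact hS.endoDeriv_eq_zero hD hA ▸ hA

omit [T2Space M] in
lemma AlmostContactMetric.θ_ne_zero (S : AlmostContactMetric 3 M) (x : M) : S.θ x ≠ 0 := by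
  intro h0
  obtain ⟨e, -, h1, -, -, h2, -⟩ := exists_orthonormal_frame (g := S.g.bilin x) (n := S.ξ x)
    (finrank_tangentSpace x) (S.g.bilin_symm x) (S.g.bilin_pos x)
    ((S.inner_ξ x _).trans (S.η_ξ x))
  have h3 := S.θ_sq x e
  rw [h0, ← S.inner_ξ, S.g.symm, show S.g.inner x e (S.ξ x) = 0 from h2] at h3
  have h4 : e = 0 := by simpa using h3
  rw [h4] at h1
  simp at h1

end ThreeDim

/-! ### Functions with vanishing derivative on a connected manifold. -/

section Constancy

variable {n : ℕ} {M : Type*} [TopologicalSpace M] [ChartedSpace (Model n) M]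

lemma mvfderiv_eq_zero_of_forall_le {f : M → ℝ} {x : M} (h : ∀ y, f x ≤ f y) :
    mvfderiv (𝓡 n) f x = 0 := by
  refine ContinuousLinearMap.ext fun v ↦ ?_
  have h1 : mfderiv (𝓡 n) 𝓘(ℝ) f x = 0 := by
    by_cases hd : MDifferentiableAt (𝓡 n) 𝓘(ℝ) f x
    · rw [hd.mfderiv, ModelWithCorners.range_eq_univ, fderivWithin_univ]
      -- Minimality is global on `M`, so the inequality holds at every `p`, even where the inverse
      -- chart takes junk values.
      exact IsLocalMin.fderiv_eq_zero (f := writtenInExtChartAt (𝓡 n) 𝓘(ℝ) x f)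
        (Filter.Eventually.of_forall fun p ↦ by
          change f ((extChartAt (𝓡 n) x).symm (extChartAt (𝓡 n) x x)) ≤
            f ((extChartAt (𝓡 n) x).symm p)
          rw [extChartAt_to_inv]
          exact h _)
    · exact mfderiv_zero_of_not_mdifferentiableAt hd
  unfold mvfderiv
  rw [h1]
  rfl

lemma eq_of_mvfderiv_eq_zero [IsManifold (𝓡 n) ∞ M] [PreconnectedSpace M] {f : M → ℝ}
    (hf : ∀ x, MDifferentiableAt (𝓡 n) 𝓘(ℝ) f x)
    (h : ∀ x, mvfderiv (𝓡 n) f x = 0) (x y : M) : f x = f y := by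
  have hm (x : M) : HasMFDerivAt (𝓡 n) 𝓘(ℝ) f x 0 := by
    have h1 := (hf x).hasMFDerivAt
    rwa [show mfderiv (𝓡 n) 𝓘(ℝ) f x = 0 from h x] at h1
  refine IsLocallyConstant.apply_eq_of_preconnectedSpace
    ((IsLocallyConstant.iff_eventually_eq f).2 fun x ↦ ?_) x y
  let e := extChartAt (𝓡 n) x
  have hd : ∀ p ∈ e.target, HasFDerivAt (f ∘ e.symm) (0 : Model n →L[ℝ] ℝ) p := fun p hp ↦ by
    have h2 : MDifferentiableAt 𝓘(ℝ, Model n) (𝓡 n) e.symm p :=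
      ((contMDiffOn_extChartAt_symm (n := 1) x).contMDiffAt
        ((isOpen_extChartAt_target x).mem_nhds hp)).mdifferentiableAt (by simp)
    have h3 := ((hm (e.symm p)).comp p h2.hasMFDerivAt).hasFDerivAt
    refine h3.congr_fderiv ?_
    exact ContinuousLinearMap.zero_comp _
  have ho := (isOpen_extChartAt_target x).isOpen_inter_preimage_of_fderiv_eq_zero (𝕜 := ℝ)
    (fun p hp ↦ (hd p hp).differentiableAt.differentiableWithinAt) (fun p hp ↦ (hd p hp).fderiv)
    {f x}
  have hmem : e x ∈ e.target ∩ (f ∘ e.symm) ⁻¹' {f x} := by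
    refine ⟨mem_extChartAt_target x, ?_⟩
    simp [e]
  filter_upwards [(continuousAt_extChartAt x).preimage_mem_nhds (ho.mem_nhds hmem),
    extChartAt_source_mem_nhds (I := 𝓡 n) x] with y hy hys
  have h4 : f (e.symm (e y)) = f x := hy.2
  rwa [(extChartAt (𝓡 n) x).left_inv hys] at h4

end Constancy

/-! ### Differentiability of the rotation speed. -/

section Speed

variable {n : ℕ} {M : Type*} [TopologicalSpace M] [ChartedSpace (Model n) M]
  [IsManifold (𝓡 n) ∞ M] {θ : (x : M) → TangentSpace (𝓡 n) x →L[ℝ] TangentSpace (𝓡 n) x}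

lemma SmoothEndo.mdifferentiableAt_speedSq (hθ : SmoothEndo θ) (x : M) :
    MDifferentiableAt (𝓡 n) 𝓘(ℝ) (fun y ↦ speedSq (θ y).toLinearMap) x := by
  let t := trivializationAt (Model n) (fun x : M ↦ TangentSpace (𝓡 n) x) x
  have hx : x ∈ t.baseSet := mem_baseSet_trivializationAt' x
  let b := Module.finBasis ℝ (Model n)
  have h1 (i) : MDifferentiableAt (𝓡 n) 𝓘(ℝ) (LinearMap.piApply (t.localFrameCoeff (𝓡 n) b i)
      (applyEndo θ (applyEndo θ (t.localFrame b i)))) x :=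
    mdifferentiableAt_localFrameCoeff b hx
      (hθ.mdifferentiableAt_apply (hθ.mdifferentiableAt_apply
        ((contMDiffAt_localFrame_of_mem 1 _ b i hx).mdifferentiableAt (by simp)))) i
  have h2 : MDifferentiableAt (𝓡 n) 𝓘(ℝ) (fun y ↦ ∑ i, LinearMap.piApply
      (t.localFrameCoeff (𝓡 n) b i) (applyEndo θ (applyEndo θ (t.localFrame b i))) y) x :=
    by
    simpa only [Finset.sum_fn] using! MDifferentiableAt.sum (t := Finset.univ) fun i _ ↦ h1 i
  refine ((mdifferentiableAt_const (c := (-2⁻¹ : ℝ))).mul h2).congr_of_eventuallyEq ?_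
  filter_upwards [t.open_baseSet.mem_nhds hx] with y hy
  rw [speedSq, LinearMap.trace_eq_matrix_trace ℝ (t.basisAt b hy), Matrix.trace]
  congr 1
  refine Finset.sum_congr rfl fun i _ ↦ ?_
  have h3 := Trivialization.localFrameCoeff_apply_of_mem_baseSet (I := 𝓡 n) t b hy
    (applyEndo θ (applyEndo θ (t.localFrame b i))) i
  refine Eq.trans ?_ h3.symm
  rw [Matrix.diag_apply, LinearMap.toMatrix_apply]
  simp [hy, applyEndo]

end Speed

/-! ### Constancy of the rotation speed. -/

section ThreeDim

variable {M : Type*} [TopologicalSpace M] [ChartedSpace (Model 3) M]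
  [IsManifold (𝓡 3) ∞ M] {θ : (x : M) → TangentSpace (𝓡 3) x →L[ℝ] TangentSpace (𝓡 3) x}
  {g : Metric 3 M} {D : CovariantDerivative (𝓡 3) (Model 3) (fun x : M ↦ TangentSpace (𝓡 3) x)}

/-- The rotation speed of a parallel skew endomorphism field is constant. -/
lemma speedSq_eq [PreconnectedSpace M] (hθ : SmoothEndo θ) (hs : IsSkew g θ)
    (hA : ∀ x, IsEndoDerivAt D θ x 0) (x y : M) :
    speedSq (θ x).toLinearMap = speedSq (θ y).toLinearMap := by
  have hd := hθ.mdifferentiableAt_speedSq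
  refine eq_of_mvfderiv_eq_zero hd (fun x ↦ ?_) x y
  -- At a zero of `θ` the squared speed attains its minimum 0. Elsewhere, differentiating `θ³ = -s
  -- θ` with `θ` parallel leaves `ds ⊗ θ = 0`.
  by_cases h0 : θ x = 0
  · refine mvfderiv_eq_zero_of_forall_le fun y ↦ ?_
    have h1 : speedSq (θ x).toLinearMap = 0 := by simp [speedSq, h0]
    rw [h1]
    exact speedSq_nonneg (finrank_tangentSpace y) (g.bilin_symm y) (g.bilin_pos y) (hs y)
  obtain ⟨v, hv⟩ : ∃ v, θ x v ≠ 0 := by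
    by_contra! h
    exact h0 (ContinuousLinearMap.ext h)
  refine ContinuousLinearMap.ext fun u ↦ ?_
  have hY := fieldMDiffAt_extend v
  set Y := extend (Model 3) v
  have hYv : Y x = v := extend_apply_self ..
  have h1 : applyEndo θ (applyEndo θ (applyEndo θ Y)) =
      -((fun y ↦ speedSq (θ y).toLinearMap) • applyEndo θ Y) := funext fun y ↦ by
    have := cube_eq_neg_speedSq_smul (finrank_tangentSpace y) (g.bilin_symm y) (g.bilin_pos y)
      (hs y) (Y y)
    rw [neg_smul] at this
    exact this
  have hθY := hθ.mdifferentiableAt_apply hY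
  have hc := cube_eq_neg_speedSq_smul (finrank_tangentSpace x) (g.bilin_symm x) (g.bilin_pos x)
      (hs x) (D Y x u)
  have h2 := hA x _ (hθ.mdifferentiableAt_apply hθY) u
  rw [h1, covDeriv_neg ((hd x).smul_section hθY), _root_.neg_apply,
    covDeriv_smul (hd x) hθY, hA x _ hθY, hA x _ hY] at h2
  simp only [LinearMap.zero_apply, zero_add] at h2
  simp only [ContinuousLinearMap.coe_coe] at hc
  rw [hc] at h2
  simp only [applyEndo, hYv] at h2
  rw [neg_add, neg_smul, add_eq_left, neg_eq_zero] at h2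
  exact (smul_eq_zero.1 h2).resolve_right hv

end ThreeDim

/-! ### Coordinate frames and their change under transition maps. -/

section ChartFrame

variable {n : ℕ} {M : Type*} [TopologicalSpace M] [ChartedSpace (Model n) M]

/-- The coordinate vector fields of a chart. -/
def chartFrame (e : OpenPartialHomeomorph M (Model n)) (i : Fin n) (x : M) :
    TangentSpace (𝓡 n) x :=
  VectorField.mpullback (𝓡 n) (𝓡 n) e (fun _ ↦ EuclideanSpace.basisFun (Fin n) ℝ i) x

variable [IsManifold (𝓡 n) ∞ M] {e e' : OpenPartialHomeomorph M (Model n)} {x : M}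

omit [IsManifold (𝓡 n) ∞ M] in
lemma mdifferentiable_of_mem_maximalAtlas (he : e ∈ IsManifold.maximalAtlas (𝓡 n) ∞ M) :
    e.MDifferentiable (𝓡 n) (𝓡 n) :=
  ⟨fun _ hx ↦ ((contMDiffAt_of_mem_maximalAtlas he hx).mdifferentiableAt
    (by simp)).mdifferentiableWithinAt,
   fun _ hx ↦ ((contMDiffAt_symm_of_mem_maximalAtlas he hx).mdifferentiableAt
    (by simp)).mdifferentiableWithinAt⟩

omit [IsManifold (𝓡 n) ∞ M] in
lemma mfderiv_chartFrame (he : e ∈ IsManifold.maximalAtlas (𝓡 n) ∞ M) (hx : x ∈ e.source)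
    (i : Fin n) :
    mfderiv (𝓡 n) (𝓡 n) e x (chartFrame e i x) = EuclideanSpace.basisFun (Fin n) ℝ i := by
  let L := (mdifferentiable_of_mem_maximalAtlas he).mfderiv hx
  have h : chartFrame e i x = L.symm (EuclideanSpace.basisFun (Fin n) ℝ i) :=
    congr($(ContinuousLinearMap.inverse_equiv L) (EuclideanSpace.basisFun (Fin n) ℝ i))
  rw [h]
  exact L.apply_symm_apply _

lemma smoothFieldAt_chartFrame (he : e ∈ IsManifold.maximalAtlas (𝓡 n) ∞ M) (hx : x ∈ e.source)
    (i : Fin n) : SmoothFieldAt (chartFrame e i) x :=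
  ContMDiffAt.mpullback_vectorField_preimage (n := ∞)
    (contMDiffAt_vectorSpace_iff_contDiffAt.2 contDiffAt_const)
    (contMDiffAt_of_mem_maximalAtlas he hx)
    ⟨(mdifferentiable_of_mem_maximalAtlas he).mfderiv hx, rfl⟩ (by simp)

omit [IsManifold (𝓡 n) ∞ M] in
lemma exists_basis_eq_chartFrame (he : e ∈ IsManifold.maximalAtlas (𝓡 n) ∞ M) (hx : x ∈ e.source) :
    ∃ b : Module.Basis (Fin n) ℝ (TangentSpace (𝓡 n) x), ⇑b = fun i ↦ chartFrame e i x := by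
  refine ⟨(EuclideanSpace.basisFun (Fin n) ℝ).toBasis.map
    ((mdifferentiable_of_mem_maximalAtlas he).mfderiv hx).symm.toLinearEquiv, funext fun i ↦ ?_⟩
  refine ((mdifferentiable_of_mem_maximalAtlas he).mfderiv hx).injective ?_
  refine Eq.trans ?_ (mfderiv_chartFrame he hx i).symm
  exact ((mdifferentiable_of_mem_maximalAtlas he).mfderiv hx).apply_symm_apply _ |>.trans
    ((EuclideanSpace.basisFun (Fin n) ℝ).coe_toBasis ▸ rfl)

omit [IsManifold (𝓡 n) ∞ M] in
lemma exists_chartFrame_change (he : e ∈ IsManifold.maximalAtlas (𝓡 n) ∞ M)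
    (he' : e' ∈ IsManifold.maximalAtlas (𝓡 n) ∞ M) (hx : x ∈ e.source) (hx' : x ∈ e'.source) :
    ∃ P : Matrix (Fin n) (Fin n) ℝ, (∀ i, chartFrame e i x = ∑ j, P i j • chartFrame e' j x) ∧
      P.det = (fderiv ℝ (fun y ↦ e' (e.symm y)) (e x)).det := by
  have hd := mdifferentiable_of_mem_maximalAtlas he
  have hd' := mdifferentiable_of_mem_maximalAtlas he'
  have hd'' : MDifferentiableAt (𝓡 n) (𝓡 n) (fun y ↦ e' (e.symm y)) (e x) :=
    MDifferentiableAt.comp_of_eq (f := e.symm) (g := e') (e x) (hd'.mdifferentiableAt hx')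
      (hd.mdifferentiableAt_symm (e.map_source hx)) (e.left_inv hx)
  set J : Model n →L[ℝ] Model n := fderiv ℝ (fun y ↦ e' (e.symm y)) (e x)
  have hJ' : mfderiv (𝓡 n) (𝓡 n) (fun y ↦ e' (e.symm y)) (e x) = J := mfderiv_eq_fderiv
  let b := (EuclideanSpace.basisFun (Fin n) ℝ).toBasis
  have hb (i : Fin n) : b i = EuclideanSpace.basisFun (Fin n) ℝ i :=
    congrFun (EuclideanSpace.basisFun (Fin n) ℝ).coe_toBasis i
  have hJ (i : Fin n) : mfderiv (𝓡 n) (𝓡 n) e' x (chartFrame e i x) = J (b i) := by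
    have h1 : (e' : M → Model n) =ᶠ[𝓝 x] (fun y ↦ e' (e.symm y)) ∘ e := by
      filter_upwards [e.open_source.mem_nhds hx] with y hy
      simp [e.left_inv hy]
    rw [h1.mfderiv_eq, hb, ← mfderiv_chartFrame he hx, ← hJ']
    exact congr($(mfderiv_comp x hd'' (hd.mdifferentiableAt hx)) (chartFrame e i x))
  -- The transpose appears because the rows of `P` hold the coefficients of the frame vectors; the
  -- determinant does not change.
  refine ⟨(LinearMap.toMatrix b b J.toLinearMap).transpose, fun i ↦ ?_, ?_⟩
  · refine (hd'.mfderiv hx').injective ?_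
    refine (hJ i).trans ?_
    rw [map_sum, ← b.sum_repr (J (b i))]
    refine Finset.sum_congr rfl fun j _ ↦ ?_
    rw [map_smul, Matrix.transpose_apply, LinearMap.toMatrix_apply, hb j]
    exact congr(_ • $((mfderiv_chartFrame he' hx' j).symm))
  · rw [Matrix.det_transpose, LinearMap.det_toMatrix]

end ChartFrame

/-! ### The oriented unit axis. -/

section Axis

variable {M : Type*} [TopologicalSpace M] [ChartedSpace (Model 3) M]
  [IsManifold (𝓡 3) ∞ M] {θ : (x : M) → TangentSpace (𝓡 3) x →L[ℝ] TangentSpace (𝓡 3) x}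
  {g : Metric 3 M} {e e' : OpenPartialHomeomorph M (Model 3)} {x : M}

/-- The axis of rotation of `θ`, oriented by the chart `e`. -/
def chartAxis (g : Metric 3 M)
    (θ : (x : M) → TangentSpace (𝓡 3) x →L[ℝ] TangentSpace (𝓡 3) x)
    (e : OpenPartialHomeomorph M (Model 3)) (x : M) : TangentSpace (𝓡 3) x :=
  axisVector (g.bilin x) (θ x).toLinearMap fun i ↦ chartFrame e i x

/-- The unit axis of rotation of `θ`, oriented by the chart `e`. -/
def unitChartAxis (g : Metric 3 M)
    (θ : (x : M) → TangentSpace (𝓡 3) x →L[ℝ] TangentSpace (𝓡 3) x)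
    (e : OpenPartialHomeomorph M (Model 3)) (x : M) : TangentSpace (𝓡 3) x :=
  (√(g.inner x (chartAxis g θ e x) (chartAxis g θ e x)))⁻¹ • chartAxis g θ e x

lemma chartAxis_ne_zero (hs : IsSkew g θ) (h0 : ∀ x, θ x ≠ 0)
    (he : e ∈ IsManifold.maximalAtlas (𝓡 3) ∞ M) (hx : x ∈ e.source) : chartAxis g θ e x ≠ 0 := by
  obtain ⟨b, hb⟩ := exists_basis_eq_chartFrame he hx
  rw [chartAxis, ← hb]
  refine axisVector_ne_zero (g.bilin_symm x) (g.bilin_pos x) (hs x) b fun h ↦ h0 x ?_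
  exact ContinuousLinearMap.ext fun v ↦ congr($h v)

lemma endo_unitChartAxis (hs : IsSkew g θ) (he : e ∈ IsManifold.maximalAtlas (𝓡 3) ∞ M)
    (hx : x ∈ e.source) : θ x (unitChartAxis g θ e x) = 0 := by
  obtain ⟨b, hb⟩ := exists_basis_eq_chartFrame he hx
  have h : θ x (chartAxis g θ e x) = 0 := by
    rw [chartAxis, ← hb]
    exact endo_axisVector (g.bilin_symm x) (g.bilin_pos x) (hs x) b
  rw [unitChartAxis, map_smul, h, smul_zero]

lemma inner_unitChartAxis (hs : IsSkew g θ) (h0 : ∀ x, θ x ≠ 0)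
    (he : e ∈ IsManifold.maximalAtlas (𝓡 3) ∞ M) (hx : x ∈ e.source) :
    g.inner x (unitChartAxis g θ e x) (unitChartAxis g θ e x) = 1 := by
  have hp := g.pos x _ (chartAxis_ne_zero hs h0 he hx)
  have h1 := (Real.sqrt_pos.2 hp).ne'
  simp only [unitChartAxis, map_smul, _root_.smul_apply, smul_eq_mul]
  field_simp
  exact (Real.sq_sqrt hp.le).symm

/-- The axis vectors differ by the Jacobian determinant, whose positivity lets normalization cancel
it; a negative one would flip the sign. -/
lemma unitChartAxis_eq (hs : IsSkew g θ) (he : e ∈ IsManifold.maximalAtlas (𝓡 3) ∞ M)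
    (he' : e' ∈ IsManifold.maximalAtlas (𝓡 3) ∞ M) (hx : x ∈ e.source) (hx' : x ∈ e'.source)
    (hdet : 0 < (fderiv ℝ (fun y ↦ e' (e.symm y)) (e x)).det) :
    unitChartAxis g θ e x = unitChartAxis g θ e' x := by
  obtain ⟨P, hP, hPdet⟩ := exists_chartFrame_change he he' hx hx'
  rw [← hPdet] at hdet
  have h : chartAxis g θ e x = P.det • chartAxis g θ e' x :=
    axisVector_change (g.bilin_symm x) (hs x) hP
  simp only [unitChartAxis, h, map_smul, _root_.smul_apply, smul_eq_mul]
  rw [← mul_assoc, Real.sqrt_mul (by positivity), Real.sqrt_mul_self hdet.le, smul_smul]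
  congr 1
  field_simp

lemma smoothFieldAt_unitChartAxis (hθ : SmoothEndo θ) (hs : IsSkew g θ) (h0 : ∀ x, θ x ≠ 0)
    (he : e ∈ IsManifold.maximalAtlas (𝓡 3) ∞ M) (hx : x ∈ e.source) :
    SmoothFieldAt (unitChartAxis g θ e) x := by
  have hE (i : Fin 3) := smoothFieldAt_chartFrame he hx i
  have hc (i j : Fin 3) := contMDiffAt_inner g (hE i) (hθ.contMDiffAt_apply (hE j))
  have hv : SmoothFieldAt (chartAxis g θ e) x :=
    (((hc 1 2).smul_section (hE 0)).add_section ((hc 2 0).smul_section (hE 1))).add_section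
      ((hc 0 1).smul_section (hE 2))
  have hp := g.pos x _ (chartAxis_ne_zero hs h0 he hx)
  have h1 : ContMDiffAt (𝓡 3) 𝓘(ℝ) ∞
      (fun y ↦ (√(g.inner y (chartAxis g θ e y) (chartAxis g θ e y)))⁻¹) x := by
    have h2 : ContDiffAt ℝ ∞ (fun t : ℝ ↦ (√t)⁻¹)
        (g.inner x (chartAxis g θ e x) (chartAxis g θ e x)) :=
      (Real.contDiffAt_sqrt hp.ne').inv (Real.sqrt_pos.2 hp).ne'
    exact ContMDiffAt.comp (g := fun t : ℝ ↦ (√t)⁻¹) x h2.contMDiffAt (contMDiffAt_inner g hv hv)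
  exact h1.smul_section hv

/-- On an oriented 3-manifold, a nowhere vanishing skew endomorphism field has a smooth unit
axis. -/
lemma exists_unit_axis (hM : Orientable 3 M) (hθ : SmoothEndo θ) (hs : IsSkew g θ)
    (h0 : ∀ x, θ x ≠ 0) : ∃ ξ : (x : M) → TangentSpace (𝓡 3) x, SmoothField ξ ∧
      (∀ x, g.inner x (ξ x) (ξ x) = 1) ∧ ∀ x, θ x (ξ x) = 0 := by
  obtain ⟨A, hA, hcov, hpos⟩ := hM
  choose e heA hx using hcov
  refine ⟨fun x ↦ unitChartAxis g θ (e x) x, fun x ↦ ?_,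
    fun x ↦ inner_unitChartAxis hs h0 (hA (heA x)) (hx x),
    fun x ↦ endo_unitChartAxis hs (hA (heA x)) (hx x)⟩
  -- The chart is chosen independently at each point; near `x` all choices agree with the axis of
  -- the fixed chart `e x`, which is smooth.
  refine (smoothFieldAt_unitChartAxis hθ hs h0 (hA (heA x)) (hx x)).congr_of_eventuallyEq ?_
  filter_upwards [(e x).open_source.mem_nhds (hx x)] with y hy
  rw [unitChartAxis_eq hs (hA (heA y)) (hA (heA x)) (hx y) hy
    (hpos _ (heA y) _ (heA x) y ⟨hx y, hy⟩)]

end Axis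

/-! ### From a parallel skew endomorphism to a coKähler structure. -/

section Converse

variable {M : Type*} [TopologicalSpace M] [ChartedSpace (Model 3) M]
  [IsManifold (𝓡 3) ∞ M] {θ : (x : M) → TangentSpace (𝓡 3) x →L[ℝ] TangentSpace (𝓡 3) x}
  {g : Metric 3 M} {ξ : (x : M) → TangentSpace (𝓡 3) x}

/-- The almost contact metric structure of a skew endomorphism field of speed one with unit
axis `ξ`. -/
def almostContactOfAxis (g : Metric 3 M) (hθ : SmoothEndo θ) (hs : IsSkew g θ) (hξ : SmoothField ξ)
    (hn : ∀ x, g.inner x (ξ x) (ξ x) = 1) (hk : ∀ x, θ x (ξ x) = 0)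
    (h1 : ∀ x, speedSq (θ x).toLinearMap = 1) : AlmostContactMetric 3 M :=
  have hsq (x : M) (v : TangentSpace (𝓡 3) x) :
      θ x (θ x v) = -v + g.inner x (ξ x) v • ξ x := by
    have h := (sq_eq_speedSq_smul (finrank_tangentSpace x) (g.bilin_symm x) (g.bilin_pos x)
      (hn x) (hs x) (hk x)).2 v
    rw [h1, one_smul] at h
    exact h
  { θ := θ
    ξ := ξ
    η := fun y ↦ g.inner y (ξ y)
    g := g
    smooth_θ := hθ
    smooth_ξ := hξ
    smooth_η := smoothOneForm_inner g hξ
    η_ξ := hn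
    θ_sq := hsq
    adapted := fun x v w ↦ by
      rw [hs, hsq, map_add, map_neg, map_smul, g.symm x v (ξ x), smul_eq_mul]
      ring }

variable {D : CovariantDerivative (𝓡 3) (Model 3) (fun x : M ↦ TangentSpace (𝓡 3) x)}

/-- From `θξ = 0` and `∇θ = 0`, `∇_u ξ` lies in the kernel of `θ`, a multiple of `ξ`; unit length
makes it orthogonal to `ξ`. -/
lemma AlmostContactMetric.D_ξ_eq_zero {S : AlmostContactMetric 3 M} (hD : IsLeviCivita S.g D)
    (hA : ∀ x, IsEndoDerivAt D S.θ x 0) (x : M) : D S.ξ x = 0 := by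
  refine ContinuousLinearMap.ext fun u ↦ ?_
  have h1 := S.endoDeriv_ξ (hA x) u
  have h2 := S.θ_sq x (D S.ξ x u)
  rw [← S.inner_ξ, S.g.symm, S.inner_D_ξ hD, ← neg_neg (S.θ x (D S.ξ x u)), ← h1] at h2
  simpa using h2

lemma AlmostContactMetric.isCoKahler_of_parallel {S : AlmostContactMetric 3 M}
    (hD : IsLeviCivita S.g D) (hA : ∀ x, IsEndoDerivAt D S.θ x 0) : S.IsCoKahler := by
  have hη (X Y : (x : M) → TangentSpace (𝓡 3) x) (hX : SmoothField X) (hY : SmoothField Y)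
      (x : M) : dOne S.η X Y x = 0 := by
    rw [show S.η = fun y ↦ S.g.inner y (S.ξ y) from
      funext fun y ↦ ContinuousLinearMap.ext fun v ↦ (S.inner_ξ y v).symm,
      hD.dOne_inner (S.smooth_ξ.mdifferentiableAt x) (hX.mdifferentiableAt x)
        (hY.mdifferentiableAt x), S.D_ξ_eq_zero hD hA]
    simp
  refine ⟨⟨hη, fun X Y Z hX hY hZ x ↦ ?_⟩, fun X Y hX hY x ↦ ?_⟩
  · refine (hD.dTwo_fundamental S.smooth_θ S.isSkew (hA x) (hX.mdifferentiableAt x)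
      (hY.mdifferentiableAt x) (hZ.mdifferentiableAt x)).trans ?_
    simp
  · rw [hη X Y hX hY, hD.nijenhuis_eq S.smooth_θ (hA x) (hX.mdifferentiableAt x)
      (hY.mdifferentiableAt x)]
    simp

theorem admitsCoKahler_of_solvesGauge [T2Space M] [PreconnectedSpace M] (hM : Orientable 3 M)
    (hθ : SmoothEndo θ) (h0 : ∃ x, θ x ≠ 0) (hs : IsSkew g θ) (hg : SolvesGauge g θ) :
    AdmitsCoKahler 3 M := by
  obtain ⟨D, hD, hgauge⟩ := hg
  obtain ⟨x₀, hx₀⟩ := h0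
  have hA := (gauge_iff_isEndoDerivAt_zero hθ).1 hgauge
  set f := speedSq (θ x₀).toLinearMap with hf
  have hfpos : 0 < f := speedSq_pos (finrank_tangentSpace x₀) (g.bilin_symm x₀) (g.bilin_pos x₀)
    (hs x₀) fun h ↦ hx₀ (ContinuousLinearMap.ext fun v ↦ congr($h v))
  have hspeed (x : M) : speedSq (θ x).toLinearMap = f := speedSq_eq hθ hs hA x x₀
  have hne (x : M) : θ x ≠ 0 := fun h ↦ by
    have := hspeed x
    rw [h] at this
    simp [speedSq] at this
    exact hfpos.ne this
  obtain ⟨ξ, hξ, hn, hk⟩ := exists_unit_axis hM hθ hs hne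
  -- Scaling `θ` by `c` multiplies the squared speed by `c²`, making it one; since `c` is constant,
  -- `c • θ` stays parallel.
  let c : ℝ := (√f)⁻¹
  have hc : c * c * f = 1 := by
    rw [← mul_inv, Real.mul_self_sqrt hfpos.le, inv_mul_cancel₀ hfpos.ne']
  have hs' : IsSkew g (c • θ) := fun x v w ↦ by
    simp [hs x v w]
  have h1 (x : M) : speedSq ((c • θ) x).toLinearMap = 1 := by
    have h2 : ((c • θ) x).toLinearMap ∘ₗ ((c • θ) x).toLinearMap =
        (c * c) • ((θ x).toLinearMap ∘ₗ (θ x).toLinearMap) := by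
      refine LinearMap.ext fun v ↦ ?_
      simp [smul_smul]
    rw [speedSq, h2, map_smul, smul_eq_mul, mul_left_comm, ← speedSq, hspeed, hc]
  let S := almostContactOfAxis g (hθ.const_smul c) hs' hξ hn (fun x ↦ by simp [hk x]) h1
  refine ⟨S, AlmostContactMetric.isCoKahler_of_parallel (D := D) hD fun x Y hY u ↦ ?_⟩
  have h2 := D.isCovariantDerivativeOn.smul_const (x := x) c (hθ.mdifferentiableAt_apply hY)
  have h3 : D (applyEndo S.θ Y) x = c • D (applyEndo θ Y) x := h2
  have h4 : S.θ x (D Y x u) = c • θ x (D Y x u) := rfl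
  rw [h3, h4, _root_.smul_apply, hA x Y hY]
  simp

end Converse

end CoKahler

end

theorem mainTheorem4 (M : Type*) [TopologicalSpace M] [T2Space M] [SecondCountableTopology M]
    [ConnectedSpace M] [ChartedSpace (CoKahler.Model 3) M] [IsManifold (𝓡 3) ∞ M]
    (hM : CoKahler.Orientable 3 M) :
    CoKahler.AdmitsCoKahler 3 M ↔
      ∃ g : CoKahler.Metric 3 M, ∃ θ : (x : M) →
          TangentSpace (𝓡 3) x →L[ℝ] TangentSpace (𝓡 3) x,
        CoKahler.SmoothEndo θ ∧ (∃ x, θ x ≠ 0) ∧ CoKahler.IsSkew g θ ∧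
        CoKahler.SolvesGauge g θ := by
  refine ⟨fun ⟨S, hS⟩ ↦ ?_, fun ⟨g, θ, hθ, h0, hs, hg⟩ ↦
    CoKahler.admitsCoKahler_of_solvesGauge hM hθ h0 hs hg⟩
  obtain ⟨x⟩ : Nonempty M := inferInstance
  exact ⟨S.g, S.θ, S.smooth_θ, ⟨x, S.θ_ne_zero x⟩, S.isSkew, hS.solvesGauge⟩
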